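/- Let $n\ge 0$, $J=[0,\infty)$ and let $A\colon J\to\mathbb R^{n\times n}$ be of bounded variation on every compact interval $[a,b]\subset J$. With $\Delta^{+}A(t)=A(t^{+})-A(t)$ and $\Delta^{-}A(t)=A(t)-A(t^{-})$, assume (D) $I-\Delta^{-}A(t)$ is invertible for every $t>0$ and $I+\Delta^{+}A(t)$ is invertible for every $t\ge 0$. Assume moreover that there are $\omega>0$ and a constant matrix $C\in\mathbb R^{n\times n}$ with $A(t+\omega)-A(t)=C$ for all $t\ge 0$. Integrals are understood as follows. For $a\le b$ and $G\colon[a,b]\times[a,b]\to X$ with $X$ a Banach space, the Kurzweil integral $\int_a^b DG(\tau,t)$ is the element $v\in X$ (if it exists) such that for every $\varepsilon>0$ there is $\delta\colon[a,b]\to(0,\infty)$ with $\bigl\|\sum_j [G(\tau_j,\alpha_j)-G(\tau_j,\alpha_{j-1})]-v\bigr\|<\varepsilon$ for all partitions $a=\alpha_0<\dots<\alpha_\nu=b$ with tags $\tau_j\in[\alpha_{j-1},\alpha_j]\subset(\tau_j-\delta(\tau_j),\tau_j+\delta(\tau_j))$; and $\int_b^a=-\int_a^b$. We write $\int_a^b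 \mathrm d[A(s)]\,x(s)$ for the case $G(\tau,t)=A(t)x(\tau)$. A solution of the homogeneous generalized linear differential equation $$\frac{dx}{d\tau}=D[A(t)x]\qquad(\ast)$$ on an interval $J'\subset J$ is a function $x\colon J'\to\mathbb R^n$ such that $x(d)-x(c)=\int_c^d \mathrm d[A(s)]\,x(s)$ (in particular, the integral exists) for all $c,d\in J'$. The trivial solution of $(\ast)$ is called globally uniformly exponentially stable if there are constants $\alpha,K>0$ such that for every $s_0\ge 0$ and every solution $x$ of $(\ast)$ on $[s_0,\infty)$, $$\|x(t)\|\le K\|x(s_0)\|e^{-\alpha(t-s_0)}\quad\text{for all } t\ge s_0 .$$ Then there is a unique $U\colon J\times J\to\mathbb R^{n\times n}$ (the transition matrix of $(\ast)$) with $U(t,s)=I+\int_s^t \mathrm d[A(r)]\,U(r,s)$ for all $t,s\in J$, and the trivial solution of $(\ast)$ is globally uniformly exponentially stable if and only if every (complex) eigenvalue $\rho$ of the monodromy matrix $X(\omega)=U(\omega,0)$ satisfies $|\rho|<1$. -/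

import Mathlib

open Set

open scoped Matrix.Norms.L2Operator

namespace GLDE

/-- A tagged partition `a = pt 0 < pt 1 < ⋯ < pt ν = b` of `[a, b]` with tags
`tag j ∈ [pt j, pt (j + 1)]` for `j < ν`. Values of `pt` and `tag` at later indices are
irrelevant. For `a = b` only `ν = 0` is possible. -/
structure TaggedPartition (a b : ℝ) where
  ν : ℕ
  pt : ℕ → ℝ
  tag : ℕ → ℝ
  pt_zero : pt 0 = a
  pt_last : pt ν = b
  pt_lt : ∀ j < ν, pt j < pt (j + 1)
  tag_mem : ∀ j < ν, tag j ∈ Icc (pt j) (pt (j + 1))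

/-- `δ`-fineness of a tagged partition. -/
def TaggedPartition.IsFine {a b : ℝ} (P : TaggedPartition a b) (δ : ℝ → ℝ) : Prop :=
  ∀ j < P.ν, Icc (P.pt j) (P.pt (j + 1)) ⊆
    Ioo (P.tag j - δ (P.tag j)) (P.tag j + δ (P.tag j))

/-- The Kurzweil sum `∑ [G(τ_j, α_j) - G(τ_j, α_{j-1})]`. -/
def TaggedPartition.sum {X : Type*} [NormedAddCommGroup X] {a b : ℝ}
    (P : TaggedPartition a b) (G : ℝ → ℝ → X) : X :=
  ∑ j ∈ Finset.range P.ν, (G (P.tag j) (P.pt (j + 1)) - G (P.tag j) (P.pt j))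

/-- For `a ≤ b`: `G` is Kurzweil integrable on `[a, b]` and its integral is `v`. -/
def HasIntegralIcc {X : Type*} [NormedAddCommGroup X]
    (G : ℝ → ℝ → X) (a b : ℝ) (v : X) : Prop :=
  ∀ ε > 0, ∃ δ : ℝ → ℝ, (∀ t ∈ Icc a b, 0 < δ t) ∧
    ∀ P : TaggedPartition a b, P.IsFine δ → ‖P.sum G - v‖ < ε

/-- The oriented Kurzweil integral: `∫_a^b DG(τ, t)` exists and equals `v`, where
`∫_a^b = -∫_b^a` when `b < a`. -/
def HasIntegral {X : Type*} [NormedAddCommGroup X]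
    (G : ℝ → ℝ → X) (a b : ℝ) (v : X) : Prop :=
  (a ≤ b → HasIntegralIcc G a b v) ∧ (b < a → HasIntegralIcc G b a (-v))

/-- `x` solves the homogeneous generalized linear differential equation `dx/dτ = D[A(t)x]`
on the interval `J`: `x(d) - x(c) = ∫_c^d d[A(s)] x(s)` for all `c, d ∈ J`. -/
def IsSolutionOn {n : ℕ} (A : ℝ → Matrix (Fin n) (Fin n) ℝ)
    (x : ℝ → EuclideanSpace ℝ (Fin n)) (J : Set ℝ) : Prop :=
  ∀ c ∈ J, ∀ d ∈ J,
    HasIntegral (fun τ t => Matrix.toEuclideanCLM (𝕜 := ℝ) (A t) (x τ)) c d (x d - x c)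

/-- `U` is a transition matrix on `[0, ∞)`: `U(t, s) = I + ∫_s^t d[A(r)] U(r, s)`
for all `t, s ≥ 0`. -/
def IsTransitionMatrix {n : ℕ} (A : ℝ → Matrix (Fin n) (Fin n) ℝ)
    (U : ℝ → ℝ → Matrix (Fin n) (Fin n) ℝ) : Prop :=
  ∀ t ∈ Ici (0 : ℝ), ∀ s ∈ Ici (0 : ℝ),
    HasIntegral (fun τ r => A r * U τ s) s t (U t s - 1)

/-- Condition (D): `I - Δ⁻A(t)` is invertible for all `t > 0` and `I + Δ⁺A(t)` is invertible
for all `t ≥ 0`. -/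
def ConditionD {n : ℕ} (A : ℝ → Matrix (Fin n) (Fin n) ℝ) : Prop :=
  (∀ t > 0, IsUnit (1 - (A t - Function.leftLim A t))) ∧
    ∀ t ≥ 0, IsUnit (1 + (Function.rightLim A t - A t))

/-- Global uniform exponential stability of the trivial solution of `dx/dτ = D[A(t)x]` on
`[0, ∞)`. The inequality is not strict, since it has to hold for `x₀ = 0` too. -/
def GloballyUniformlyExponentiallyStable {n : ℕ} (A : ℝ → Matrix (Fin n) (Fin n) ℝ) : Prop :=
  ∃ α > 0, ∃ K > 0, ∀ s₀ ≥ 0, ∀ x : ℝ → EuclideanSpace ℝ (Fin n),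
    IsSolutionOn A x (Ici s₀) →
      ∀ t ≥ s₀, ‖x t‖ ≤ K * ‖x s₀‖ * Real.exp (-α * (t - s₀))

end GLDE

/-! A solution is governed by the jumps of `A` and by its small variation between them. Integration
against `A` costs at most the supremum norm times the variation. On an open interval where the
variation is at most 1/2 the integral operator is therefore a contraction, which gives uniqueness
and, by Picard iteration, existence. Large jumps sit only at end points, where x(t⁺) = (I +
Δ⁺A(t))x(t) and x(t⁻) = (I - Δ⁻A(t))x(t); condition (D) lets solutions cross them in both
directions. The connectedness argument `interval_induction` spreads these local results over compact
intervals: `SolOn.eq_zero` is uniqueness from either end point, `exists_solOn_Icc` is existence.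

For the matrix equation this yields Φ on [0,∞) with Φ(0) = I. Backward uniqueness makes each Φ(t)
invertible (`isUnit_fundamental`), so U(t,s) = Φ(t)Φ(s)⁻¹. Since A(t+ω) - A(t) is constant, t ↦
Φ(t+ω) solves the same equation, whence Φ(t+kω) = Φ(t)Φ(ω)^k (`fundamental_add_nat_mul`).

If the eigenvalues of Φ(ω) lie in the open unit disc, Gelfand's formula makes its powers decay
exponentially (`exists_norm_pow_le`), and bounds for Φ and Φ⁻¹ over one period turn this into a
uniform estimate of U (`exists_exp_bound`). Conversely, stability forces Φ(ω)^k v → 0 for every v,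
hence ρ^k → 0 for each eigenvalue ρ (`norm_eigenvalue_lt_one`). -/

namespace GLDE

open Filter Topology

/-! ### The Kurzweil integral: fine partitions, additivity, jumps of the indefinite integral. -/

section Kurzweil

variable {X Y : Type*} [NormedAddCommGroup X] [NormedAddCommGroup Y]

/-- `FineSum G δ a b S`: the value `S` is the Kurzweil sum of `G` over some `δ`-fine tagged
partition of `[a, b]`. -/
inductive FineSum (G : ℝ → ℝ → X) (δ : ℝ → ℝ) : ℝ → ℝ → X → Prop
  | nil (a : ℝ) : FineSum G δ a a 0
  | cons {a c b τ : ℝ} {S : X} (hac : a < c) (hτ : τ ∈ Icc a c)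
      (hδ : Icc a c ⊆ Ioo (τ - δ τ) (τ + δ τ)) (h : FineSum G δ c b S) :
      FineSum G δ a b (G τ c - G τ a + S)

variable {G G' : ℝ → ℝ → X} {δ δ' : ℝ → ℝ} {a b c : ℝ} {S S' v w : X}

theorem FineSum.le (h : FineSum G δ a b S) : a ≤ b := by
  induction h with
  | nil a => exact le_rfl
  | cons hac _ _ _ ih => exact hac.le.trans ih

theorem FineSum.append (h : FineSum G δ a b S) (h' : FineSum G δ b c S') :
    FineSum G δ a c (S + S') := by
  induction h with
  | nil a => simpa using h'
  | cons hac hτ hδ _ ih => rw [add_assoc]; exact .cons hac hτ hδ (ih h')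

theorem FineSum.mono (h : FineSum G δ a b S) (hδ : ∀ t ∈ Icc a b, δ t ≤ δ' t) :
    FineSum G δ' a b S := by
  induction h with
  | nil a => exact .nil a
  | cons hac hτ hf h ih =>
    have hcb := h.le
    have := hδ _ ⟨hτ.1, hτ.2.trans hcb⟩
    exact .cons hac hτ (hf.trans (Ioo_subset_Ioo (by linarith) (by linarith)))
      (ih fun t ht => hδ t ⟨hac.le.trans ht.1, ht.2⟩)

theorem FineSum.congr (h : FineSum G δ a b S)
    (hG : ∀ τ ∈ Icc a b, ∀ t ∈ Icc a b, G τ t = G' τ t) : FineSum G' δ a b S := by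
  induction h with
  | nil a => exact .nil a
  | cons hac hτ hf h ih =>
    have hcb := h.le
    have hτ' := And.intro hτ.1 (hτ.2.trans hcb)
    rw [hG _ hτ' _ ⟨hac.le, hcb⟩, hG _ hτ' _ ⟨le_rfl, hac.le.trans hcb⟩]
    exact .cons hac hτ hf (ih fun τ hτ t ht =>
      hG τ ⟨hac.le.trans hτ.1, hτ.2⟩ t ⟨hac.le.trans ht.1, ht.2⟩)

theorem FineSum.single {τ : ℝ} (hac : a < c) (hτ : τ ∈ Icc a c)
    (hδ : Icc a c ⊆ Ioo (τ - δ τ) (τ + δ τ)) : FineSum G δ a c (G τ c - G τ a) := by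
  simpa using FineSum.cons (G := G) hac hτ hδ (.nil c)

/-- A gauge that isolates `b` forces every fine partition to split at `b`. -/
theorem FineSum.split (h : FineSum G δ a c S) (hab : a ≤ b) (hbc : b ≤ c)
    (hδ : ∀ t ∈ Icc a c, t ≠ b → δ t ≤ |t - b|) :
    ∃ S₁ S₂, FineSum G δ a b S₁ ∧ FineSum G δ b c S₂ ∧ S = S₁ + S₂ := by
  induction h with
  | nil a =>
    obtain rfl := le_antisymm hab hbc
    exact ⟨0, 0, .nil _, .nil _, by simp⟩
  | @cons a d c τ S hac hτ hf h ih =>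
    rcases hab.eq_or_lt with rfl | hab
    · exact ⟨0, _, .nil _, .cons hac hτ hf h, by simp⟩
    have hdc := h.le
    rcases le_or_gt d b with hdb | hbd
    · obtain ⟨S₁, S₂, h₁, h₂, rfl⟩ := ih hdb hbc fun t ht =>
        hδ t ⟨hac.le.trans ht.1, ht.2⟩
      exact ⟨_, S₂, .cons hac hτ hf h₁, h₂, by abel⟩
    -- A piece with `b` in its interior must be tagged at `b`; cutting it there leaves two pieces
    -- with the same tag, whose increments add up to the old one.
    · have hτb : τ = b := by
        by_contra hne
        have h1 := hδ τ ⟨hτ.1, hτ.2.trans hdc⟩ hne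
        have h2 := hf ⟨hab.le, hbd.le⟩
        rcases abs_cases (τ - b) with h3 | h3 <;> linarith [h2.1, h2.2]
      subst hτb
      exact ⟨_, _, .single hab ⟨hab.le, le_rfl⟩ ((Icc_subset_Icc_right hbd.le).trans hf),
        .cons hbd ⟨le_rfl, hbd.le⟩ ((Icc_subset_Icc_left hab.le).trans hf) h, by abel⟩

/-- The supremum of the points reachable from `a` is itself reachable, by the local condition on its
left; if it were below `b`, the condition on its right would lead past it. -/
theorem interval_induction {P : ℝ → ℝ → Prop} (hab : a ≤ b) (refl : ∀ t ∈ Icc a b, P t t)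
    (trans : ∀ r s t, a ≤ r → r ≤ s → s ≤ t → t ≤ b → P r s → P s t → P r t)
    (loc : ∀ t ∈ Icc a b, ∃ δ > 0, (∀ s ∈ Icc a b, s < t → t - δ < s → P s t) ∧
      ∀ s ∈ Icc a b, t < s → s < t + δ → P t s) : P a b := by
  set T := {t | t ∈ Icc a b ∧ P a t} with hT
  have haT : a ∈ T := ⟨⟨le_rfl, hab⟩, refl a ⟨le_rfl, hab⟩⟩
  have hbdd : BddAbove T := ⟨b, fun t ht => ht.1.2⟩
  set m := sSup T
  have ham : a ≤ m := le_csSup hbdd haT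
  have hmb : m ≤ b := csSup_le ⟨a, haT⟩ fun t ht => ht.1.2
  obtain ⟨δ, hδ, hl, hr⟩ := loc m ⟨ham, hmb⟩
  obtain ⟨s, hs, hsm⟩ := exists_lt_of_lt_csSup ⟨a, haT⟩ (show m - δ < m by linarith)
  have hPm : P a m := by
    rcases (le_csSup hbdd hs).eq_or_lt with h | h
    · have : s = m := h
      exact this ▸ hs.2
    · exact trans a s m le_rfl hs.1.1 h.le hmb hs.2 (hl s hs.1 h hsm)
  rcases hmb.eq_or_lt with h | h
  · exact h ▸ hPm
  · exfalso
    have h1 : m < min b (m + δ / 2) := lt_min h (by linarith)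
    have h2 : min b (m + δ / 2) ∈ Icc a b := ⟨ham.trans h1.le, min_le_left _ _⟩
    have h3 : min b (m + δ / 2) < m + δ := (min_le_right _ _).trans_lt (by linarith)
    exact h1.not_ge (le_csSup hbdd
      ⟨h2, trans a m _ le_rfl ham h1.le h2.2 hPm (hr _ h2 h1 h3)⟩)

/-- The Cousin lemma: fine partitions exist. -/
theorem exists_fineSum (G : ℝ → ℝ → X) (hab : a ≤ b) (hδ : ∀ t ∈ Icc a b, 0 < δ t) :
    ∃ S, FineSum G δ a b S := by
  refine interval_induction (P := fun s t => ∃ S, FineSum G δ s t S) hab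
    (fun t _ => ⟨0, .nil t⟩) ?_ ?_
  · rintro r s t - - - - ⟨S, h⟩ ⟨S', h'⟩
    exact ⟨_, h.append h'⟩
  · intro t ht
    have := hδ t ht
    refine ⟨δ t, this, fun s _ hst hs => ⟨_, .single hst ⟨hst.le, le_rfl⟩ ?_⟩,
      fun s _ hst hs => ⟨_, .single hst ⟨le_rfl, hst.le⟩ ?_⟩⟩ <;>
    · intro r hr
      constructor <;> linarith [hr.1, hr.2]

theorem FineSum.exists_partition (h : FineSum G δ a b S) :
    ∃ P : TaggedPartition a b, P.IsFine δ ∧ P.sum G = S := by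
  induction h with
  | nil a => exact ⟨⟨0, fun _ => a, fun _ => a, rfl, rfl, by simp, by simp⟩,
      by simp [TaggedPartition.IsFine], by simp [TaggedPartition.sum]⟩
  | @cons a c b τ S hac hτ hf h ih =>
    obtain ⟨P, hP, rfl⟩ := ih
    refine ⟨⟨P.ν + 1, fun j => Nat.casesOn j a P.pt, fun j => Nat.casesOn j τ P.tag, rfl,
      P.pt_last, ?_, ?_⟩, ?_, ?_⟩
    · rintro (_ | j) hj
      · simpa [P.pt_zero] using hac
      · exact P.pt_lt j (by omega)
    · rintro (_ | j) hj
      · simpa [P.pt_zero] using hτ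
      · exact P.tag_mem j (by omega)
    · rintro (_ | j) hj
      · simpa [P.pt_zero] using hf
      · exact hP j (Nat.lt_of_succ_lt_succ hj)
    · simp only [TaggedPartition.sum, Finset.sum_range_succ', P.pt_zero]
      exact add_comm _ _

theorem TaggedPartition.fineSum (P : TaggedPartition a b) (hP : P.IsFine δ) (G : ℝ → ℝ → X) :
    FineSum G δ a b (P.sum G) := by
  obtain ⟨ν, pt, tag, h0, h1, hlt, hmem⟩ := P
  induction ν generalizing a pt tag with
  | zero =>
    obtain rfl : a = b := h0.symm.trans h1
    simpa [TaggedPartition.sum] using FineSum.nil (G := G) (δ := δ) a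
  | succ k ih =>
    have := ih (a := pt 1) (fun j => pt (j + 1)) (fun j => tag (j + 1)) rfl h1
      (fun j hj => hlt (j + 1) (by omega)) (fun j hj => hmem (j + 1) (by omega))
      (fun j hj => hP (j + 1) (Nat.succ_lt_succ hj))
    subst h0
    have h := FineSum.cons (hlt 0 (by omega)) (hmem 0 (by omega)) (hP 0 (Nat.succ_pos k)) this
    rw [TaggedPartition.sum, Finset.sum_range_succ', add_comm]
    exact h

/-- With partitions in inductive form, estimates of sums become inductions that peel off the
leftmost piece. -/
theorem hasIntegralIcc_iff : HasIntegralIcc G a b v ↔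
    ∀ ε > 0, ∃ δ : ℝ → ℝ, (∀ t ∈ Icc a b, 0 < δ t) ∧
      ∀ S, FineSum G δ a b S → ‖S - v‖ < ε := by
  refine forall₂_congr fun ε _ => exists_congr fun δ => and_congr_right fun _ => ?_
  constructor
  · intro h S hS
    obtain ⟨P, hP, rfl⟩ := hS.exists_partition
    exact h P hP
  · exact fun h P hP => h _ (P.fineSum hP G)

theorem HasIntegralIcc.unique (hab : a ≤ b) (h : HasIntegralIcc G a b v)
    (h' : HasIntegralIcc G a b w) : v = w := by
  rw [hasIntegralIcc_iff] at h h'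
  refine eq_of_forall_dist_le fun ε hε => ?_
  obtain ⟨δ, hδ, hS⟩ := h (ε / 2) (half_pos hε)
  obtain ⟨δ', hδ', hS'⟩ := h' (ε / 2) (half_pos hε)
  obtain ⟨S, h⟩ := exists_fineSum (δ := fun t => min (δ t) (δ' t)) G hab
    fun t ht => lt_min (hδ t ht) (hδ' t ht)
  have h1 := hS S (h.mono fun _ _ => min_le_left _ _)
  have h2 := hS' S (h.mono fun _ _ => min_le_right _ _)
  rw [← dist_eq_norm] at h1 h2
  linarith [dist_triangle_left v w S]

theorem HasIntegralIcc.refl (G : ℝ → ℝ → X) (a : ℝ) : HasIntegralIcc G a a 0 := by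
  rw [hasIntegralIcc_iff]
  refine fun ε hε => ⟨fun _ => 1, fun _ _ => one_pos, fun S hS => ?_⟩
  cases hS with
  | nil => simpa using hε
  | cons hac _ _ h => exact absurd h.le hac.not_ge

theorem HasIntegralIcc.congr (h : HasIntegralIcc G a b v)
    (hG : ∀ τ ∈ Icc a b, ∀ t ∈ Icc a b, G τ t = G' τ t) : HasIntegralIcc G' a b v := by
  rw [hasIntegralIcc_iff] at h ⊢
  intro ε hε
  obtain ⟨δ, hδ, hS⟩ := h ε hε
  exact ⟨δ, hδ, fun S h => hS S (h.congr fun τ hτ t ht => (hG τ hτ t ht).symm)⟩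

theorem HasIntegralIcc.trans (hab : a ≤ b) (hbc : b ≤ c) (h : HasIntegralIcc G a b v)
    (h' : HasIntegralIcc G b c w) : HasIntegralIcc G a c (v + w) := by
  rw [hasIntegralIcc_iff] at h h' ⊢
  intro ε hε
  obtain ⟨δ, hδ, hS⟩ := h (ε / 2) (half_pos hε)
  obtain ⟨δ', hδ', hS'⟩ := h' (ε / 2) (half_pos hε)
  -- Capping the gauge by the distance to `b` forces every fine partition to split there.
  refine ⟨fun t => if t < b then min (δ t) |t - b| else if b < t then min (δ' t) |t - b|
    else min (δ t) (δ' t), fun t ht => ?_, fun S hS₀ => ?_⟩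
  · dsimp only
    split_ifs with h1 h2
    · exact lt_min (hδ t ⟨ht.1, h1.le⟩) (abs_pos.2 (sub_ne_zero.2 h1.ne))
    · exact lt_min (hδ' t ⟨h2.le, ht.2⟩) (abs_pos.2 (sub_ne_zero.2 h2.ne'))
    · exact lt_min (hδ t ⟨ht.1, not_lt.1 h2⟩) (hδ' t ⟨not_lt.1 h1, ht.2⟩)
  · obtain ⟨S₁, S₂, h₁, h₂, rfl⟩ := hS₀.split hab hbc fun t _ htb => by
      rcases lt_or_gt_of_ne htb with h | h
      · simp [h]
      · simp [h, h.not_gt]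
    have e₁ := hS S₁ (h₁.mono fun t ht => by
      rcases ht.2.eq_or_lt with rfl | h
      · simp
      · simp [h])
    have e₂ := hS' S₂ (h₂.mono fun t ht => by
      rcases ht.1.eq_or_lt with rfl | h
      · simp
      · simp [h, h.not_gt])
    calc ‖S₁ + S₂ - (v + w)‖ = ‖(S₁ - v) + (S₂ - w)‖ := by congr 1; abel
      _ ≤ ‖S₁ - v‖ + ‖S₂ - w‖ := norm_add_le _ _
      _ < ε := by linarith

/-- A single fine sum over [a, b] is held fixed and put in front of all fine sums over [b, c]. Since
the value on the remaining interval is known in advance, no Cauchy criterion is needed. -/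
theorem HasIntegralIcc.sub_left (hab : a ≤ b) (hbc : b ≤ c) (h : HasIntegralIcc G a b v)
    (h' : HasIntegralIcc G a c w) : HasIntegralIcc G b c (w - v) := by
  rw [hasIntegralIcc_iff] at h h' ⊢
  intro ε hε
  obtain ⟨δ, hδ, hS⟩ := h (ε / 2) (half_pos hε)
  obtain ⟨δ', hδ', hS'⟩ := h' (ε / 2) (half_pos hε)
  obtain ⟨S₀, h₀⟩ := exists_fineSum (δ := fun t => min (δ t) (δ' t)) G hab
    fun t ht => lt_min (hδ t ht) (hδ' t ⟨ht.1, ht.2.trans hbc⟩)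
  refine ⟨δ', fun t ht => hδ' t ⟨hab.trans ht.1, ht.2⟩, fun S h₁ => ?_⟩
  have e₁ := hS S₀ (h₀.mono fun _ _ => min_le_left _ _)
  have e₂ := hS' _ ((h₀.mono fun _ _ => min_le_right _ _).append h₁)
  calc ‖S - (w - v)‖ = ‖(S₀ + S - w) - (S₀ - v)‖ := by congr 1; abel
    _ ≤ ‖S₀ + S - w‖ + ‖S₀ - v‖ := norm_sub_le _ _
    _ < ε := by linarith

theorem HasIntegralIcc.sub_right (hab : a ≤ b) (hbc : b ≤ c) (h : HasIntegralIcc G b c v)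
    (h' : HasIntegralIcc G a c w) : HasIntegralIcc G a b (w - v) := by
  rw [hasIntegralIcc_iff] at h h' ⊢
  intro ε hε
  obtain ⟨δ, hδ, hS⟩ := h (ε / 2) (half_pos hε)
  obtain ⟨δ', hδ', hS'⟩ := h' (ε / 2) (half_pos hε)
  obtain ⟨S₀, h₀⟩ := exists_fineSum (δ := fun t => min (δ t) (δ' t)) G hbc
    fun t ht => lt_min (hδ t ht) (hδ' t ⟨hab.trans ht.1, ht.2⟩)
  refine ⟨δ', fun t ht => hδ' t ⟨ht.1, ht.2.trans hbc⟩, fun S h₁ => ?_⟩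
  have e₁ := hS S₀ (h₀.mono fun _ _ => min_le_left _ _)
  have e₂ := hS' _ (h₁.append (h₀.mono fun _ _ => min_le_right _ _))
  calc ‖S - (w - v)‖ = ‖(S + S₀ - w) - (S₀ - v)‖ := by congr 1; abel
    _ ≤ ‖S + S₀ - w‖ + ‖S₀ - v‖ := norm_sub_le _ _
    _ < ε := by linarith

theorem HasIntegralIcc.add (h : HasIntegralIcc G a b v) (h' : HasIntegralIcc G' a b w) :
    HasIntegralIcc (fun τ t => G τ t + G' τ t) a b (v + w) := by
  intro ε hε
  obtain ⟨δ, hδ, hS⟩ := h (ε / 2) (half_pos hε)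
  obtain ⟨δ', hδ', hS'⟩ := h' (ε / 2) (half_pos hε)
  refine ⟨fun t => min (δ t) (δ' t), fun t ht => lt_min (hδ t ht) (hδ' t ht), fun P hP => ?_⟩
  have e₁ := hS P fun j hj => (hP j hj).trans <| Ioo_subset_Ioo
    (sub_le_sub_left (min_le_left _ _) _) (add_le_add_right (min_le_left _ _) _)
  have e₂ := hS' P fun j hj => (hP j hj).trans <| Ioo_subset_Ioo
    (sub_le_sub_left (min_le_right _ _) _) (add_le_add_right (min_le_right _ _) _)
  have : P.sum (fun τ t => G τ t + G' τ t) = P.sum G + P.sum G' := by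
    simp only [TaggedPartition.sum, ← Finset.sum_add_distrib]
    exact Finset.sum_congr rfl fun _ _ => by abel
  calc ‖P.sum (fun τ t => G τ t + G' τ t) - (v + w)‖
      = ‖(P.sum G - v) + (P.sum G' - w)‖ := by rw [this]; congr 1; abel
    _ ≤ ‖P.sum G - v‖ + ‖P.sum G' - w‖ := norm_add_le _ _
    _ < ε := by linarith

theorem HasIntegralIcc.map [NormedSpace ℝ X] [NormedSpace ℝ Y] (T : X →L[ℝ] Y)
    (h : HasIntegralIcc G a b v) : HasIntegralIcc (fun τ t => T (G τ t)) a b (T v) := by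
  intro ε hε
  have hT : 0 < ‖T‖ + 1 := by positivity
  obtain ⟨δ, hδ, hS⟩ := h (ε / (‖T‖ + 1)) (div_pos hε hT)
  refine ⟨δ, hδ, fun P hP => ?_⟩
  have : P.sum (fun τ t => T (G τ t)) = T (P.sum G) := by
    simp only [TaggedPartition.sum, map_sum, map_sub]
  rw [this, ← map_sub]
  have h1 := hS P hP
  rw [lt_div_iff₀ hT] at h1
  have h2 := T.le_opNorm (P.sum G - v)
  nlinarith [norm_nonneg (P.sum G - v)]

theorem HasIntegralIcc.translate (s : ℝ) (h : HasIntegralIcc G (a + s) (b + s) v) :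
    HasIntegralIcc (fun τ t => G (τ + s) (t + s)) a b v := by
  intro ε hε
  obtain ⟨δ, hδ, hS⟩ := h ε hε
  refine ⟨fun t => δ (t + s), fun t ht => hδ _ ⟨add_le_add_left ht.1 s,
    add_le_add_left ht.2 s⟩, fun P hP => ?_⟩
  refine hS ⟨P.ν, fun j => P.pt j + s, fun j => P.tag j + s, by rw [P.pt_zero],
    by rw [P.pt_last], fun j hj => add_lt_add_left (P.pt_lt j hj) s,
    fun j hj => ⟨add_le_add_left (P.tag_mem j hj).1 s, add_le_add_left (P.tag_mem j hj).2 s⟩⟩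
    fun j hj r hr => ?_
  have := hP j hj ⟨le_sub_iff_add_le.2 hr.1, sub_le_iff_le_add.2 hr.2⟩
  exact ⟨by simpa using by linarith [this.1], by simpa using by linarith [this.2]⟩

theorem HasIntegral.of_le (hab : a ≤ b) (h : HasIntegralIcc G a b v) : HasIntegral G a b v :=
  ⟨fun _ => h, fun h' => absurd hab h'.not_ge⟩

theorem HasIntegral.symm (h : HasIntegral G a b v) : HasIntegral G b a (-v) := by
  refine ⟨fun hba => ?_, fun hab => by simpa using h.1 hab.le⟩
  rcases hba.eq_or_lt with rfl | hba
  · have := (h.1 le_rfl).unique le_rfl (.refl G b)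
    simpa [this] using HasIntegralIcc.refl G b
  · exact h.2 hba

theorem HasIntegral.icc_of_ge (hab : b ≤ a) (h : HasIntegral G a b v) :
    HasIntegralIcc G b a (-v) := h.symm.1 hab

theorem HasIntegral.trans (h : HasIntegral G a b v) (h' : HasIntegral G b c w) :
    HasIntegral G a c (v + w) := by
  rcases le_total a b with hab | hab <;> rcases le_total b c with hbc | hbc
  · exact .of_le (hab.trans hbc) ((h.1 hab).trans hab hbc (h'.1 hbc))
  · rcases le_total a c with hac | hac
    · exact .of_le hac (by simpa [add_comm] using (h'.icc_of_ge hbc).sub_right hac hbc (h.1 hab))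
    · have := HasIntegralIcc.sub_right hac hab (h.1 hab) (h'.icc_of_ge hbc)
      simpa [add_comm] using (HasIntegral.of_le hac this).symm
  · rcases le_total a c with hac | hac
    · exact .of_le hac (by simpa [add_comm] using
        HasIntegralIcc.sub_left hab hac (h.icc_of_ge hab) (h'.1 hbc))
    · have := HasIntegralIcc.sub_left hbc hac (h'.1 hbc) (h.icc_of_ge hab)
      simpa [add_comm] using (HasIntegral.of_le hac this).symm
  · have := (h'.icc_of_ge hbc).trans hbc hab (h.icc_of_ge hab)
    simpa [add_comm] using (HasIntegral.of_le (hbc.trans hab) this).symm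

theorem HasIntegral.map [NormedSpace ℝ X] [NormedSpace ℝ Y] (T : X →L[ℝ] Y)
    (h : HasIntegral G a b v) : HasIntegral (fun τ t => T (G τ t)) a b (T v) :=
  ⟨fun hab => (h.1 hab).map T, fun hab => by simpa using (h.2 hab).map T⟩

theorem HasIntegral.add (h : HasIntegral G a b v) (h' : HasIntegral G' a b w) :
    HasIntegral (fun τ t => G τ t + G' τ t) a b (v + w) :=
  ⟨fun hab => (h.1 hab).add (h'.1 hab), fun hab => by
    simpa [add_comm] using (h.2 hab).add (h'.2 hab)⟩

theorem HasIntegral.congr (h : HasIntegral G a b v)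
    (hG : ∀ τ ∈ uIcc a b, ∀ t ∈ uIcc a b, G τ t = G' τ t) : HasIntegral G' a b v :=
  ⟨fun hab => (h.1 hab).congr (by rwa [uIcc_of_le hab] at hG),
    fun hab => (h.2 hab).congr (by rwa [uIcc_of_ge hab.le] at hG)⟩

/-- The indefinite integral has the same right jump at `a` as `G a`. -/
theorem tendsto_integral_nhdsGT {F : ℝ → X} (hab : a < b)
    (h : ∀ t ∈ Icc a b, HasIntegralIcc G a t (F t - F a)) :
    Tendsto (fun t => F t - F a - (G a t - G a a)) (𝓝[>] a) (𝓝 0) := by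
  rw [Metric.tendsto_nhds]
  intro ε hε
  obtain ⟨δ, hδ, hS⟩ := hasIntegralIcc_iff.1 (h b ⟨hab.le, le_rfl⟩) (ε / 2) (half_pos hε)
  have hδa := hδ a ⟨le_rfl, hab.le⟩
  filter_upwards [Ioo_mem_nhdsGT (show a < min b (a + δ a) from lt_min hab (by linarith))]
    with t ht
  have htb : t < b := ht.2.trans_le (min_le_left _ _)
  have htδ : t < a + δ a := ht.2.trans_le (min_le_right _ _)
  have h1 := HasIntegralIcc.sub_left ht.1.le htb.le (h t ⟨ht.1.le, htb.le⟩)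
    (h b ⟨hab.le, le_rfl⟩)
  obtain ⟨δ', hδ', hS'⟩ := hasIntegralIcc_iff.1 h1 (ε / 2) (half_pos hε)
  obtain ⟨S, h₀⟩ := exists_fineSum (δ := fun t => min (δ t) (δ' t)) G htb.le
    fun s hs => lt_min (hδ s ⟨ht.1.le.trans hs.1, hs.2⟩) (hδ' s hs)
  -- One sum over [t, b] is used twice: alone, and preceded by the piece [a, t] tagged at `a`.
  -- Comparing the two estimates isolates the jump term.
  have e₁ := hS _ (.cons ht.1 ⟨le_rfl, ht.1.le⟩ (fun r hr => ⟨by linarith [hr.1],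
    by linarith [hr.2]⟩) (h₀.mono fun _ _ => min_le_left _ _))
  have e₂ := hS' S (h₀.mono fun _ _ => min_le_right _ _)
  rw [dist_zero_right]
  calc ‖F t - F a - (G a t - G a a)‖
      = ‖(S - (F b - F a - (F t - F a))) - (G a t - G a a + S - (F b - F a))‖ := by
        congr 1; abel
    _ ≤ _ := norm_sub_le _ _
    _ < ε := by linarith

/-- The indefinite integral has the same left jump at `b` as `G b`. -/
theorem tendsto_integral_nhdsLT {F : ℝ → X} (hab : a < b)
    (h : ∀ t ∈ Icc a b, HasIntegralIcc G a t (F t - F a)) :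
    Tendsto (fun t => F b - F t - (G b b - G b t)) (𝓝[<] b) (𝓝 0) := by
  rw [Metric.tendsto_nhds]
  intro ε hε
  obtain ⟨δ, hδ, hS⟩ := hasIntegralIcc_iff.1 (h b ⟨hab.le, le_rfl⟩) (ε / 2) (half_pos hε)
  have hδb := hδ b ⟨hab.le, le_rfl⟩
  filter_upwards [Ioo_mem_nhdsLT (show max a (b - δ b) < b from max_lt hab (by linarith))]
    with t ht
  have hat : a < t := (le_max_left _ _).trans_lt ht.1
  have htδ : b - δ b < t := (le_max_right _ _).trans_lt ht.1
  obtain ⟨δ', hδ', hS'⟩ := hasIntegralIcc_iff.1 (h t ⟨hat.le, ht.2.le⟩) (ε / 2) (half_pos hε)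
  obtain ⟨S, h₀⟩ := exists_fineSum (δ := fun t => min (δ t) (δ' t)) G hat.le
    fun s hs => lt_min (hδ s ⟨hs.1, hs.2.trans ht.2.le⟩) (hδ' s hs)
  have e₁ := hS _ ((h₀.mono fun _ _ => min_le_left _ _).append
    (.single ht.2 ⟨ht.2.le, le_rfl⟩ fun r hr => ⟨by linarith [hr.1], by linarith [hr.2]⟩))
  have e₂ := hS' S (h₀.mono fun _ _ => min_le_right _ _)
  rw [dist_zero_right]
  calc ‖F b - F t - (G b b - G b t)‖
      = ‖(S - (F t - F a)) - (S + (G b b - G b t) - (F b - F a))‖ := by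
        congr 1; abel
    _ ≤ _ := norm_sub_le _ _
    _ < ε := by linarith

end Kurzweil

/-! ### Domination of the variation and one-sided limits. -/

/-- The monotone function `V` dominates the variation of `A`. -/
structure VarBound {R : Type*} [NormedAddCommGroup R] (A : ℝ → R) (V : ℝ → ℝ) : Prop where
  mono : Monotone V
  norm_le : ∀ s t, s ≤ t → ‖A t - A s‖ ≤ V t - V s

/-- All one-sided limits exist. -/
def IsRegulated {R : Type*} [NormedAddCommGroup R] (f : ℝ → R) : Prop :=
  ∀ t, (∃ l, Tendsto f (𝓝[<] t) (𝓝 l)) ∧ ∃ l, Tendsto f (𝓝[>] t) (𝓝 l)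

theorem VarBound.dist_le {R : Type*} [NormedAddCommGroup R] {A : ℝ → R} {V : ℝ → ℝ}
    (hA : VarBound A V) (s t : ℝ) : dist (A s) (A t) ≤ dist (V s) (V t) := by
  rcases le_total s t with h | h
  · rw [dist_comm, dist_eq_norm, dist_comm, Real.dist_eq]
    exact (hA.norm_le s t h).trans (le_abs_self _)
  · rw [dist_eq_norm, Real.dist_eq]
    exact (hA.norm_le t s h).trans (le_abs_self _)

/-- Lets a function inherit its one-sided limits from the monotone function that dominates it. -/
theorem cauchy_map_of_dist_le {R : Type*} [NormedAddCommGroup R] {A : ℝ → R}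
    {V : ℝ → ℝ} (h : ∀ s t, dist (A s) (A t) ≤ dist (V s) (V t)) {l : Filter ℝ}
    (hV : Cauchy (map V l)) : Cauchy (map A l) := by
  rw [Metric.cauchy_iff] at hV ⊢
  refine ⟨(map_neBot_iff _).2 ((map_neBot_iff _).1 hV.1), fun ε hε => ?_⟩
  obtain ⟨T, hT, hd⟩ := hV.2 ε hε
  refine ⟨A '' (V ⁻¹' T), image_mem_map hT, ?_⟩
  rintro _ ⟨s, hs, rfl⟩ _ ⟨t, ht, rfl⟩
  exact (h s t).trans_lt (hd _ hs _ ht)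

theorem VarBound.isRegulated {R : Type*} [NormedAddCommGroup R] [CompleteSpace R] {A : ℝ → R}
    {V : ℝ → ℝ} (hA : VarBound A V) : IsRegulated A := fun t =>
  ⟨cauchy_map_iff_exists_tendsto.1
      (cauchy_map_of_dist_le hA.dist_le (hA.mono.tendsto_nhdsLT t).cauchy_map),
    cauchy_map_iff_exists_tendsto.1
      (cauchy_map_of_dist_le hA.dist_le (hA.mono.tendsto_nhdsGT t).cauchy_map)⟩

theorem IsRegulated.indicator_Ioo {R : Type*} [NormedAddCommGroup R] {f : ℝ → R}
    (hf : IsRegulated f) (a b : ℝ) : IsRegulated ((Ioo a b).indicator f) := by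
  intro t
  constructor
  · by_cases h : a < t ∧ t ≤ b
    · obtain ⟨l, hl⟩ := (hf t).1
      refine ⟨l, hl.congr' ?_⟩
      filter_upwards [Ioo_mem_nhdsLT h.1] with s hs
      rw [indicator_of_mem (show s ∈ Ioo a b from ⟨hs.1, hs.2.trans_le h.2⟩)]
    · refine ⟨0, tendsto_const_nhds.congr' ?_⟩
      rw [not_and_or, not_lt, not_le] at h
      rcases h with h | h
      · filter_upwards [self_mem_nhdsWithin] with s hs
        rw [indicator_of_notMem fun h' => (h'.1.trans_le (le_of_lt hs)).not_ge h]
      · filter_upwards [Ioo_mem_nhdsLT h] with s hs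
        rw [indicator_of_notMem fun h' => (hs.1.trans h'.2).false]
  · by_cases h : a ≤ t ∧ t < b
    · obtain ⟨l, hl⟩ := (hf t).2
      refine ⟨l, hl.congr' ?_⟩
      filter_upwards [Ioo_mem_nhdsGT h.2] with s hs
      rw [indicator_of_mem (show s ∈ Ioo a b from ⟨h.1.trans_lt hs.1, hs.2⟩)]
    · refine ⟨0, tendsto_const_nhds.congr' ?_⟩
      rw [not_and_or, not_lt, not_le] at h
      rcases h with h | h
      · filter_upwards [Ioo_mem_nhdsGT h] with s hs
        rw [indicator_of_notMem fun h' => (hs.2.trans h'.1).false]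
      · filter_upwards [self_mem_nhdsWithin] with s hs
        rw [indicator_of_notMem fun h' => (h.trans_lt hs).not_gt h'.2]

/-! ### Stieltjes integrals of regulated functions. -/

section Stieltjes

variable {F : Type*} [NormedAddCommGroup F] [NormedSpace ℝ F]

/-- The integrand `G(τ, t) = A(t) x(τ)` of the Stieltjes integral `∫ d[A] x`. -/
abbrev stieltjes (A : ℝ → F →L[ℝ] F) (x : ℝ → F) : ℝ → ℝ → F := fun τ t => A t (x τ)

variable {A : ℝ → F →L[ℝ] F} {V : ℝ → ℝ} {f g x : ℝ → F} {δ : ℝ → ℝ} {a b c M : ℝ} {v w S : F}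

theorem FineSum.norm_le (hA : VarBound A V) (hx : ∀ τ ∈ Icc a b, ‖x τ‖ ≤ M)
    (h : FineSum (stieltjes A x) δ a b S) : ‖S‖ ≤ M * (V b - V a) := by
  induction h with
  | nil a => simp
  | @cons a c b τ S hac hτ _ h ih =>
    have hcb := h.le
    have h1 := ih fun τ hτ => hx τ ⟨hac.le.trans hτ.1, hτ.2⟩
    have h2 := hx τ ⟨hτ.1, hτ.2.trans hcb⟩
    have h3 : ‖A c (x τ) - A a (x τ)‖ ≤ (V c - V a) * M := by
      rw [← sub_apply]
      exact (ContinuousLinearMap.le_opNorm _ _).trans (mul_le_mul (hA.norm_le a c hac.le) h2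
        (norm_nonneg _) (sub_nonneg.2 (hA.mono hac.le)))
    calc _ ≤ ‖A c (x τ) - A a (x τ)‖ + ‖S‖ := norm_add_le _ _
      _ ≤ _ := by linarith

theorem HasIntegralIcc.norm_le (hA : VarBound A V) (hab : a ≤ b)
    (hx : ∀ τ ∈ Icc a b, ‖x τ‖ ≤ M) (h : HasIntegralIcc (stieltjes A x) a b v) :
    ‖v‖ ≤ M * (V b - V a) := by
  refine le_of_forall_pos_le_add fun ε hε => ?_
  obtain ⟨δ, hδ, hS⟩ := hasIntegralIcc_iff.1 h ε hε
  obtain ⟨S, h'⟩ := exists_fineSum (stieltjes A x) hab hδ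
  linarith [hS S h', h'.norm_le hA hx, norm_sub_norm_le v S, norm_sub_rev v S]

theorem HasIntegralIcc.stieltjes_add (h : HasIntegralIcc (stieltjes A f) a b v)
    (h' : HasIntegralIcc (stieltjes A g) a b w) :
    HasIntegralIcc (stieltjes A fun t => f t + g t) a b (v + w) :=
  (h.add h').congr fun _ _ _ _ => by simp

theorem HasIntegralIcc.stieltjes_sub (h : HasIntegralIcc (stieltjes A f) a b v)
    (h' : HasIntegralIcc (stieltjes A g) a b w) :
    HasIntegralIcc (stieltjes A fun t => f t - g t) a b (v - w) := by
  have := h.add (h'.map (-ContinuousLinearMap.id ℝ F))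
  simp only [neg_apply, ContinuousLinearMap.id_apply, ← sub_eq_add_neg]
    at this
  exact this.congr fun _ _ _ _ => by simp

theorem hasIntegralIcc_const (A : ℝ → F →L[ℝ] F) (v : F) (a b : ℝ) :
    HasIntegralIcc (stieltjes A fun _ => v) a b (A b v - A a v) := by
  rw [hasIntegralIcc_iff]
  refine fun ε hε => ⟨fun _ => 1, fun _ _ => one_pos, fun S hS => ?_⟩
  have : S = A b v - A a v := by
    induction hS with
    | nil a => simp
    | cons _ _ _ _ ih => rw [ih]; abel
  simpa [this] using hε

/-- The gauge forces the first tag to be `a`. All later tags lie to the right of `a` and contribute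
nothing, so the sum is the increment of `A` over a short first piece, applied to `v`. -/
theorem hasIntegralIcc_point_left (hA : VarBound A V) {B : F →L[ℝ] F}
    (hB : Tendsto A (𝓝[>] a) (𝓝 B)) (hab : a < b) (v : F) :
    HasIntegralIcc (stieltjes A fun t => if t = a then v else 0) a b ((B - A a) v) := by
  rw [hasIntegralIcc_iff]
  intro ε hε
  have h1 : Tendsto (fun t => A t v) (𝓝[>] a) (𝓝 (B v)) :=
    ((ContinuousLinearMap.apply ℝ F v).continuous.tendsto B).comp hB
  obtain ⟨u, hu, hsub⟩ := mem_nhdsGT_iff_exists_Ioo_subset.1 (h1 (Metric.ball_mem_nhds _ hε))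
  refine ⟨fun t => if t = a then u - a else |t - a|, fun t _ => ?_, fun S hS => ?_⟩
  · dsimp only
    split_ifs with h
    · exact sub_pos.2 hu
    · exact abs_pos.2 (sub_ne_zero.2 h)
  · cases hS with
    | nil => exact absurd hab (lt_irrefl _)
    | @cons _ c _ τ S hac hτ hf h =>
      have hτa : τ = a := by
        by_contra hne
        have h2 := hf ⟨le_rfl, hac.le⟩
        rw [if_neg hne] at h2
        rcases abs_cases (τ - a) with h3 | h3 <;> linarith [h2.1, h2.2]
      subst hτa
      have hS0 : ‖S‖ ≤ 0 * (V b - V c) := h.norm_le hA fun t ht => by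
        rw [if_neg (hac.trans_le ht.1).ne', norm_zero]
      obtain rfl : S = 0 := norm_le_zero_iff.1 (by simpa using hS0)
      have hc := (hf ⟨hac.le, le_rfl⟩).2
      rw [if_pos rfl] at hc
      have := hsub ⟨hac, by linarith⟩
      simpa [stieltjes, dist_eq_norm] using this

theorem hasIntegralIcc_point_right {B : F →L[ℝ] F}
    (hB : Tendsto A (𝓝[<] b) (𝓝 B)) (hab : a < b) (v : F) :
    HasIntegralIcc (stieltjes A fun t => if t = b then v else 0) a b ((A b - B) v) := by
  rw [hasIntegralIcc_iff]
  intro ε hε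
  have h1 : Tendsto (fun t => A t v) (𝓝[<] b) (𝓝 (B v)) :=
    ((ContinuousLinearMap.apply ℝ F v).continuous.tendsto B).comp hB
  obtain ⟨u, hu, hsub⟩ := mem_nhdsLT_iff_exists_Ioo_subset.1 (h1 (Metric.ball_mem_nhds _ hε))
  refine ⟨fun t => if t = b then b - u else |t - b|, fun t _ => ?_, fun S hS => ?_⟩
  · dsimp only
    split_ifs with h
    · exact sub_pos.2 hu
    · exact abs_pos.2 (sub_ne_zero.2 h)
  -- Partitions are peeled from the left while the mass sits at the right end: the left end point
  -- must vary in the induction, and `e` stands for `b` so that the gauge and the integrand stay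
  -- fixed.
  · have key : ∀ e, FineSum (stieltjes A fun t => if t = b then v else 0)
        (fun t => if t = b then b - u else |t - b|) a e S → e = b → a < b →
        ∃ c ∈ Ioo u b, S = A b v - A c v := by
      intro e h
      clear hS hab
      induction h with
      | nil => intro h h'; exact absurd h h'.ne
      | @cons a c e τ S hac hτ hf h ih =>
        rintro rfl -
        rcases h.le.eq_or_lt with rfl | hcb
        · have hτc : τ = c := by
            by_contra hne
            have h2 := hf ⟨hac.le, le_rfl⟩
            rw [if_neg hne] at h2
            rcases abs_cases (τ - c) with h3 | h3 <;> linarith [h2.1, h2.2]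
          subst hτc
          have ha := (hf ⟨le_rfl, hac.le⟩).1
          rw [if_pos rfl] at ha
          refine ⟨a, ⟨by linarith, hac⟩, ?_⟩
          cases h with
          | nil => simp [stieltjes]
          | cons h1 _ _ h2 => exact absurd h2.le h1.not_ge
        · obtain ⟨d, hd, rfl⟩ := ih rfl hcb
          exact ⟨d, hd, by simp [stieltjes, (hτ.2.trans_lt hcb).ne]⟩
    obtain ⟨c, hc, rfl⟩ := key b hS rfl hab
    have := hsub hc
    rw [mem_preimage, Metric.mem_ball, dist_comm, dist_eq_norm] at this
    simpa using this

/-- Functions that are constant on the open interval are integrable. -/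
theorem exists_hasIntegralIcc_of_const_on_Ioo [CompleteSpace F] (hA : VarBound A V)
    (hab : a < b) (hc : ∀ t ∈ Ioo a b, g t = v) :
    ∃ w, HasIntegralIcc (stieltjes A g) a b w := by
  obtain ⟨L, hL⟩ := (hA.isRegulated b).1
  obtain ⟨R, hR⟩ := (hA.isRegulated a).2
  refine ⟨_, (((hasIntegralIcc_const A v a b).stieltjes_add
    (hasIntegralIcc_point_left hA hR hab (g a - v))).stieltjes_add
    (hasIntegralIcc_point_right hL hab (g b - v))).congr fun τ hτ t _ => ?_⟩
  refine congrArg (A t) ?_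
  rcases hτ.1.eq_or_lt with rfl | h1
  · simp [hab.ne]
  rcases hτ.2.eq_or_lt with rfl | h2
  · simp [h1.ne']
  · simp [h1.ne', h2.ne, hc τ ⟨h1, h2⟩]

/-- The bound by supremum norm times variation makes the integrals Cauchy, and it also bounds the
difference of the sums of `g` and `f n` uniformly over all partitions. -/
theorem exists_hasIntegralIcc_of_uniform_limit [CompleteSpace F] (hA : VarBound A V)
    (hab : a ≤ b) {f : ℕ → ℝ → F} {ε : ℕ → ℝ} (hε : Tendsto ε atTop (𝓝 0))
    (hanti : Antitone ε) (hfg : ∀ n, ∀ τ ∈ Icc a b, ‖g τ - f n τ‖ ≤ ε n) {I : ℕ → F}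
    (hI : ∀ n, HasIntegralIcc (stieltjes A (f n)) a b (I n)) :
    ∃ v, HasIntegralIcc (stieltjes A g) a b v ∧ Tendsto I atTop (𝓝 v) := by
  have hW : 0 ≤ V b - V a := sub_nonneg.2 (hA.mono hab)
  have hcau : CauchySeq I := by
    refine cauchySeq_of_le_tendsto_0 (fun n => (2 * (V b - V a)) * ε n) (fun n m N hn hm => ?_)
      (by simpa using hε.const_mul (2 * (V b - V a)))
    rw [dist_eq_norm]
    refine (((hI n).stieltjes_sub (hI m)).norm_le hA hab (M := 2 * ε N) fun τ hτ => ?_).trans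
      (by linarith)
    calc ‖f n τ - f m τ‖ = ‖(g τ - f m τ) - (g τ - f n τ)‖ := by congr 1; abel
      _ ≤ ‖g τ - f m τ‖ + ‖g τ - f n τ‖ := norm_sub_le _ _
      _ ≤ 2 * ε N := by linarith [hfg n τ hτ, hfg m τ hτ, hanti hn, hanti hm]
  obtain ⟨v, hv⟩ := cauchySeq_tendsto_of_complete hcau
  refine ⟨v, fun η hη => ?_, hv⟩
  have e1 : ∀ᶠ n in atTop, ε n * (V b - V a) < η / 3 := by
    have : Tendsto (fun n => ε n * (V b - V a)) atTop (𝓝 0) := by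
      simpa using hε.mul_const (V b - V a)
    exact this.eventually (gt_mem_nhds (by positivity))
  have e2 : ∀ᶠ n in atTop, dist (I n) v < η / 3 := hv (Metric.ball_mem_nhds _ (by positivity))
  obtain ⟨n, h1, h2⟩ := (e1.and e2).exists
  obtain ⟨δ, hδ, hS⟩ := hI n (η / 3) (by positivity)
  refine ⟨δ, hδ, fun P hP => ?_⟩
  have h3 := (P.fineSum hP (stieltjes A fun τ => g τ - f n τ)).norm_le hA (hfg n)
  have h4 : P.sum (stieltjes A g) =
      P.sum (stieltjes A fun τ => g τ - f n τ) + P.sum (stieltjes A (f n)) := by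
    simp only [TaggedPartition.sum, ← Finset.sum_add_distrib, map_sub]
    exact Finset.sum_congr rfl fun _ _ => by abel
  have h5 := hS P hP
  rw [dist_eq_norm] at h2
  calc ‖P.sum (stieltjes A g) - v‖ = ‖P.sum (stieltjes A fun τ => g τ - f n τ) +
        (P.sum (stieltjes A (f n)) - I n) + (I n - v)‖ := by rw [h4]; congr 1; abel
    _ ≤ _ := norm_add₃_le
    _ < η := by linarith

/-- Regulated functions are integrable with respect to functions of bounded variation. -/
theorem IsRegulated.exists_hasIntegralIcc [CompleteSpace F] (hA : VarBound A V)
    (hf : IsRegulated f) (hab : a ≤ b) : ∃ v, HasIntegralIcc (stieltjes A f) a b v := by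
  -- Exact agreement at the end points is what allows neighbouring approximants to be glued.
  have key : ∀ ε > 0, ∃ g v, HasIntegralIcc (stieltjes A g) a b v ∧
      (g a = f a ∧ g b = f b) ∧ ∀ τ ∈ Icc a b, ‖f τ - g τ‖ ≤ ε := by
    intro ε hε
    have step : ∀ s t l, s < t → (∀ r ∈ Ioo s t, ‖f r - l‖ ≤ ε) →
        ∃ g v, HasIntegralIcc (stieltjes A g) s t v ∧
          (g s = f s ∧ g t = f t) ∧ ∀ τ ∈ Icc s t, ‖f τ - g τ‖ ≤ ε := by
      intro s t l hst h
      obtain ⟨v, hv⟩ := exists_hasIntegralIcc_of_const_on_Ioo (v := l)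
        (g := fun r => if r ∈ Ioo s t then l else f r) hA hst fun r hr => if_pos hr
      refine ⟨_, v, hv, by simp, fun τ _ => ?_⟩
      split_ifs with hτ
      · exact h τ hτ
      · simpa using hε.le
    refine interval_induction (P := fun s t => ∃ g v, HasIntegralIcc (stieltjes A g) s t v ∧
      (g s = f s ∧ g t = f t) ∧ ∀ τ ∈ Icc s t, ‖f τ - g τ‖ ≤ ε) hab ?_ ?_ ?_
    · exact fun t _ => ⟨f, 0, .refl _ t, ⟨rfl, rfl⟩, fun τ _ => by simpa using hε.le⟩
    · rintro r s t - hrs hst - ⟨g₁, v₁, h₁, ⟨hr, hs⟩, e₁⟩ ⟨g₂, v₂, h₂, ⟨hs', ht⟩, e₂⟩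
      have E₁ : ∀ τ ∈ Icc r s, (if τ ≤ s then g₁ τ else g₂ τ) = g₁ τ := fun τ hτ => if_pos hτ.2
      have E₂ : ∀ τ ∈ Icc s t, (if τ ≤ s then g₁ τ else g₂ τ) = g₂ τ := fun τ hτ => by
        rcases hτ.1.eq_or_lt with rfl | h
        · simp [hs, hs']
        · rw [if_neg h.not_ge]
      refine ⟨fun τ => if τ ≤ s then g₁ τ else g₂ τ, v₁ + v₂, (h₁.congr fun τ hτ t _ =>
        congrArg (A t) (E₁ τ hτ).symm).trans hrs hst (h₂.congr fun τ hτ t _ =>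
        congrArg (A t) (E₂ τ hτ).symm), ⟨(E₁ r ⟨le_rfl, hrs⟩).trans hr,
        (E₂ t ⟨hst, le_rfl⟩).trans ht⟩, fun τ hτ => ?_⟩
      dsimp only
      rcases le_total τ s with h | h
      · rw [E₁ τ ⟨hτ.1, h⟩]; exact e₁ τ ⟨hτ.1, h⟩
      · rw [E₂ τ ⟨h, hτ.2⟩]; exact e₂ τ ⟨h, hτ.2⟩
    · intro t _
      obtain ⟨⟨l, hl⟩, ⟨r, hr⟩⟩ := hf t
      obtain ⟨p, hp, hp'⟩ := mem_nhdsLT_iff_exists_Ioo_subset.1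
        (hl (Metric.closedBall_mem_nhds _ hε))
      obtain ⟨q, hq, hq'⟩ := mem_nhdsGT_iff_exists_Ioo_subset.1
        (hr (Metric.closedBall_mem_nhds _ hε))
      refine ⟨min (t - p) (q - t), lt_min (sub_pos.2 hp) (sub_pos.2 hq),
        fun s _ hst hs => step s t l hst fun u hu => ?_,
        fun s _ hst hs => step t s r hst fun u hu => ?_⟩
      · have := hp' ⟨by linarith [min_le_left (t - p) (q - t), hu.1], hu.2⟩
        rwa [mem_preimage, Metric.mem_closedBall, dist_eq_norm] at this
      · have := hq' ⟨hu.1, by linarith [min_le_right (t - p) (q - t), hu.2]⟩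
        rwa [mem_preimage, Metric.mem_closedBall, dist_eq_norm] at this
  choose g I hI _ he using fun n : ℕ => key (1 / ((n : ℝ) + 1)) (by positivity)
  obtain ⟨v, hv, -⟩ := exists_hasIntegralIcc_of_uniform_limit hA hab
    tendsto_one_div_add_atTop_nhds_zero_nat
    (fun m n hmn => one_div_le_one_div_of_le (by positivity) (by simpa using hmn)) he hI
  exact ⟨v, hv⟩

end Stieltjes

/-! ### The jump condition; uniqueness and existence of solutions. -/

/-- `A` has locally bounded variation, dominated by `V`, and the jump factors `1 - Δ⁻A` and
`1 + Δ⁺A` are invertible everywhere. -/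
structure Admissible {R : Type*} [NormedRing R] (A : ℝ → R) (V : ℝ → ℝ) : Prop
    extends VarBound A V where
  left : ∀ t, ∃ B, Tendsto A (𝓝[<] t) (𝓝 B) ∧ IsUnit (1 - (A t - B))
  right : ∀ t, ∃ B, Tendsto A (𝓝[>] t) (𝓝 B) ∧ IsUnit (1 + (B - A t))

/-- The interval omits `t`, because the jump of `V` at `t` need not be small. -/
theorem exists_small_right {V : ℝ → ℝ} (hV : Monotone V) (t : ℝ) :
    ∃ u > t, ∀ r ∈ Ioo t u, ∀ s ∈ Ioo t u, V s - V r ≤ 1 / 2 := by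
  obtain ⟨T, hT, hd⟩ :=
    (Metric.cauchy_iff.1 (hV.tendsto_nhdsGT t).cauchy_map).2 (1 / 2) (by norm_num)
  obtain ⟨u, hu, hsub⟩ := mem_nhdsGT_iff_exists_Ioo_subset.1 (mem_map.1 hT)
  exact ⟨u, hu, fun r hr s hs =>
    (le_abs_self _).trans (hd _ (hsub hs) _ (hsub hr)).le⟩

theorem exists_small_left {V : ℝ → ℝ} (hV : Monotone V) (t : ℝ) :
    ∃ u < t, ∀ r ∈ Ioo u t, ∀ s ∈ Ioo u t, V s - V r ≤ 1 / 2 := by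
  obtain ⟨T, hT, hd⟩ :=
    (Metric.cauchy_iff.1 (hV.tendsto_nhdsLT t).cauchy_map).2 (1 / 2) (by norm_num)
  obtain ⟨u, hu, hsub⟩ := mem_nhdsLT_iff_exists_Ioo_subset.1 (mem_map.1 hT)
  exact ⟨u, hu, fun r hr s hs =>
    (le_abs_self _).trans (hd _ (hsub hs) _ (hsub hr)).le⟩

section Solutions

variable {F : Type*} [NormedAddCommGroup F] [NormedSpace ℝ F]

/-- `x` solves `dx/dτ = D[A(t)x]` on `J`. -/
def SolOn (A : ℝ → F →L[ℝ] F) (x : ℝ → F) (J : Set ℝ) : Prop :=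
  ∀ c ∈ J, ∀ d ∈ J, HasIntegral (stieltjes A x) c d (x d - x c)

variable {A : ℝ → F →L[ℝ] F} {B : F →L[ℝ] F} {V : ℝ → ℝ} {f x y : ℝ → F} {I J : Set ℝ}
  {a b c s t M : ℝ} {v w S : F}

theorem SolOn.mono (h : SolOn A x J) (hI : I ⊆ J) : SolOn A x I :=
  fun c hc d hd => h c (hI hc) d (hI hd)

theorem SolOn.sub (h : SolOn A x J) (h' : SolOn A y J) : SolOn A (fun t => x t - y t) J := by
  intro c hc d hd
  have := (h c hc d hd).add ((h' c hc d hd).map (-ContinuousLinearMap.id ℝ F))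
  simp only [neg_apply, ContinuousLinearMap.id_apply, ← sub_eq_add_neg] at this
  rw [show x d - y d - (x c - y c) = x d - x c - (y d - y c) by abel]
  exact this.congr fun _ _ _ _ => by simp

theorem SolOn.congr (hJ : J.OrdConnected) (h : SolOn A x J) (hxy : ∀ t ∈ J, x t = y t) :
    SolOn A y J := by
  intro c hc d hd
  rw [← hxy c hc, ← hxy d hd]
  exact (h c hc d hd).congr fun τ hτ t _ =>
    congrArg (A t) (hxy τ (hJ.uIcc_subset hc hd hτ))

theorem solOn_of_base (h : ∀ t ∈ J, HasIntegral (stieltjes A x) s t (x t - x s)) :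
    SolOn A x J := by
  intro c hc d hd
  have := (h c hc).symm.trans (h d hd)
  rwa [show -(x c - x s) + (x d - x s) = x d - x c by abel] at this

theorem SolOn.tendsto_nhdsGT (h : SolOn A x (Icc a b)) (hab : a < b)
    (hB : Tendsto A (𝓝[>] a) (𝓝 B)) :
    Tendsto x (𝓝[>] a) (𝓝 ((1 + (B - A a)) (x a))) := by
  have h1 := tendsto_integral_nhdsGT hab fun t ht =>
    (h a ⟨le_rfl, hab.le⟩ t ht).1 ht.1
  have h2 : Tendsto (fun t => A t (x a)) (𝓝[>] a) (𝓝 (B (x a))) :=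
    ((ContinuousLinearMap.apply ℝ F (x a)).continuous.tendsto B).comp hB
  have h3 := (h1.add h2).add_const (x a - A a (x a))
  refine (h3.congr fun t => ?_).trans_eq ?_
  · simp only [stieltjes]; abel
  · congr 1; simp; abel

theorem SolOn.tendsto_nhdsLT (h : SolOn A x (Icc a b)) (hab : a < b)
    (hB : Tendsto A (𝓝[<] b) (𝓝 B)) :
    Tendsto x (𝓝[<] b) (𝓝 ((1 - (A b - B)) (x b))) := by
  have h1 := tendsto_integral_nhdsLT hab fun t ht =>
    (h a ⟨le_rfl, hab.le⟩ t ht).1 ht.1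
  have h2 : Tendsto (fun t => A t (x b)) (𝓝[<] b) (𝓝 (B (x b))) :=
    ((ContinuousLinearMap.apply ℝ F (x b)).continuous.tendsto B).comp hB
  have h3 := (h2.sub h1).add_const (x b - A b (x b))
  refine (h3.congr fun t => ?_).trans_eq ?_
  · simp only [stieltjes]; abel
  · congr 1; simp; abel

theorem SolOn.norm_sub_le (hA : VarBound A V) (h : SolOn A x J) (hJ : J.OrdConnected)
    (hs : s ∈ J) (ht : t ∈ J) (hst : s ≤ t) (hM : ∀ r ∈ J, ‖x r‖ ≤ M) :
    ‖x t - x s‖ ≤ M * (V t - V s) :=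
  ((h s hs t ht).1 hst).norm_le hA hst fun r hr => hM r (hJ.out hs ht hr)

/-- A bound N for x on `J` gives ‖x r - x s‖ ≤ N/2; letting s run along `l` halves the bound, and
this is iterated. The filter covers both a zero at a point of `J` and a zero one-sided limit at an
end point outside `J`. -/
theorem SolOn.eq_zero_of_small (hA : VarBound A V) (h : SolOn A x J) (hJ : J.OrdConnected)
    (hV : ∀ r ∈ J, ∀ s ∈ J, V s - V r ≤ 1 / 2) (hM : ∀ r ∈ J, ‖x r‖ ≤ M) {l : Filter ℝ}
    [l.NeBot] (hl : J ∈ l) (h0 : Tendsto x l (𝓝 0)) : ∀ r ∈ J, x r = 0 := by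
  have key : ∀ k : ℕ, ∀ r ∈ J, ‖x r‖ ≤ M * (1 / 2) ^ k := by
    intro k
    induction k with
    | zero => simpa using hM
    | succ k ih =>
      intro r hr
      have hN : 0 ≤ M * (1 / 2) ^ k := (norm_nonneg _).trans (ih r hr)
      have h1 : Tendsto (fun s => ‖x r - x s‖) l (𝓝 ‖x r - 0‖) := (h0.const_sub (x r)).norm
      rw [sub_zero] at h1
      refine le_of_tendsto h1 ?_
      filter_upwards [hl] with s hs
      rw [pow_succ, ← mul_assoc]
      rcases le_total s r with hsr | hsr
      · exact (h.norm_sub_le hA hJ hs hr hsr ih).trans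
          (mul_le_mul_of_nonneg_left (hV s hs r hr) hN)
      · rw [norm_sub_rev]
        exact (h.norm_sub_le hA hJ hr hs hsr ih).trans
          (mul_le_mul_of_nonneg_left (hV r hr s hs) hN)
  intro r hr
  have h1 : Tendsto (fun k : ℕ => M * (1 / 2 : ℝ) ^ k) atTop (𝓝 (M * 0)) :=
    (tendsto_pow_atTop_nhds_zero_of_lt_one (by norm_num) (by norm_num)).const_mul M
  rw [mul_zero] at h1
  exact norm_le_zero_iff.1 (ge_of_tendsto' h1 fun k => key k r hr)

theorem eq_zero_of_isUnit_apply {T : F →L[ℝ] F} (hT : IsUnit T) (h : T v = 0) : v = 0 := by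
  obtain ⟨u, rfl⟩ := hT
  have : ((u⁻¹ : (F →L[ℝ] F)ˣ) : F →L[ℝ] F) ((u : F →L[ℝ] F) v) = v := by
    rw [← mul_apply_eq_comp, Units.inv_mul, one_apply_eq_self]
  rw [← this, h, map_zero]

theorem exists_norm_le_of_tendsto {R : Type*} [NormedAddCommGroup R] {x : ℝ → R} {l : Filter ℝ}
    {w : R} (h : Tendsto x l (𝓝 w)) : ∃ M, ∀ᶠ s in l, ‖x s‖ ≤ M :=
  ⟨‖w‖ + 1, (h.norm.eventually (gt_mem_nhds (lt_add_one _))).mono fun _ => le_of_lt⟩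

/-- A solution that vanishes at one endpoint vanishes identically. -/
theorem SolOn.eq_zero (hA : Admissible A V) (hab : a ≤ b) (h : SolOn A x (Icc a b))
    (h0 : x a = 0 ∨ x b = 0) : ∀ t ∈ Icc a b, x t = 0 := by
  -- The property must allow a zero at either end: only then is it transitive, since the zero may
  -- have to travel in either direction through the middle point.
  have key := interval_induction (a := a) (b := b)
    (P := fun s t => x s = 0 ∨ x t = 0 → ∀ r ∈ Icc s t, x r = 0) hab ?_ ?_ ?_
  · exact key h0
  · intro t _ ht r hr
    obtain rfl : r = t := le_antisymm hr.2 hr.1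
    exact ht.elim id id
  · intro r s t _ hrs hst _ h₁ h₂ hrt
    have h₁' : x r = 0 → x s = 0 := fun h => h₁ (.inl h) s ⟨hrs, le_rfl⟩
    have h₂' : x t = 0 → x s = 0 := fun h => h₂ (.inr h) s ⟨le_rfl, hst⟩
    have hs : x s = 0 := hrt.elim h₁' h₂'
    intro u hu
    rcases le_total u s with h | h
    · exact h₁ (.inr hs) u ⟨hu.1, h⟩
    · exact h₂ (.inl hs) u ⟨h, hu.2⟩
  · intro t ht
    have hl : ∃ δ > 0, ∀ s ∈ Icc a b, s < t → t - δ < s →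
        (x s = 0 ∨ x t = 0 → ∀ r ∈ Icc s t, x r = 0) := by
      rcases ht.1.eq_or_lt with rfl | hat
      · exact ⟨1, one_pos, fun s hs h => absurd hs.1 h.not_ge⟩
      obtain ⟨u, hu, hsmall⟩ := exists_small_left hA.mono t
      obtain ⟨B, hB, hunit⟩ := hA.left t
      have hlim := (h.mono (Icc_subset_Icc_right ht.2)).tendsto_nhdsLT hat hB
      obtain ⟨M, hM⟩ := exists_norm_le_of_tendsto hlim
      obtain ⟨p, hp, hpM⟩ := mem_nhdsLT_iff_exists_Ioo_subset.1 hM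
      have hp' : p < t := hp
      refine ⟨t - max u p, sub_pos.2 (max_lt hu hp), fun s hs hst hs' h0 => ?_⟩
      have hus : u < s := (le_max_left u p).trans_lt (by linarith)
      have hps : p < s := (le_max_right u p).trans_lt (by linarith)
      have hI : Ico s t ∈ 𝓝[<] t := Ico_mem_nhdsLT hst
      have hsol := h.mono (show Ico s t ⊆ Icc a b from
        fun r hr => ⟨hs.1.trans hr.1, hr.2.le.trans ht.2⟩)
      have hz : ∀ r ∈ Ico s t, x r = 0 := by
        have := fun (l : Filter ℝ) (_ : l.NeBot) => hsol.eq_zero_of_small (l := l)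
          hA.toVarBound ordConnected_Ico (fun r hr s' hs' => hsmall r
          ⟨hus.trans_le hr.1, hr.2⟩ s' ⟨hus.trans_le hs'.1, hs'.2⟩)
          (fun r hr => hpM ⟨hps.trans_le hr.1, hr.2⟩)
        rcases h0 with h0 | h0
        · exact this (pure s) inferInstance ⟨le_rfl, hst⟩ (by
            rw [tendsto_pure_left]; intro U hU; rw [h0]; exact mem_of_mem_nhds hU)
        · exact this (𝓝[<] t) inferInstance hI (by simpa [h0] using hlim)
      intro r hr
      rcases hr.2.eq_or_lt with rfl | hrt
      -- The left limit (I - Δ⁻A)x at the end point is zero, and invertibility carries this to the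
      -- value there.
      · refine eq_zero_of_isUnit_apply hunit (tendsto_nhds_unique hlim ?_)
        exact tendsto_const_nhds.congr' (by filter_upwards [hI] with q hq; exact (hz q hq).symm)
      · exact hz r ⟨hr.1, hrt⟩
    have hr : ∃ δ > 0, ∀ s ∈ Icc a b, t < s → s < t + δ →
        (x t = 0 ∨ x s = 0 → ∀ r ∈ Icc t s, x r = 0) := by
      rcases ht.2.eq_or_lt with rfl | htb
      · exact ⟨1, one_pos, fun s hs h => absurd hs.2 h.not_ge⟩
      obtain ⟨u, hu, hsmall⟩ := exists_small_right hA.mono t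
      obtain ⟨B, hB, hunit⟩ := hA.right t
      have hlim := (h.mono (Icc_subset_Icc_left ht.1)).tendsto_nhdsGT htb hB
      obtain ⟨M, hM⟩ := exists_norm_le_of_tendsto hlim
      obtain ⟨p, hp, hpM⟩ := mem_nhdsGT_iff_exists_Ioo_subset.1 hM
      have hp' : t < p := hp
      refine ⟨min u p - t, sub_pos.2 (lt_min hu hp), fun s hs hst hs' h0 => ?_⟩
      have hus : s < u := lt_of_lt_of_le (by linarith) (min_le_left u p)
      have hps : s < p := lt_of_lt_of_le (by linarith) (min_le_right u p)
      have hI : Ioc t s ∈ 𝓝[>] t := Ioc_mem_nhdsGT hst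
      have hsol := h.mono (show Ioc t s ⊆ Icc a b from
        fun r hr => ⟨ht.1.trans hr.1.le, hr.2.trans hs.2⟩)
      have hz : ∀ r ∈ Ioc t s, x r = 0 := by
        have := fun (l : Filter ℝ) (_ : l.NeBot) => hsol.eq_zero_of_small (l := l)
          hA.toVarBound ordConnected_Ioc (fun r hr s' hs' => hsmall r
          ⟨hr.1, hr.2.trans_lt hus⟩ s' ⟨hs'.1, hs'.2.trans_lt hus⟩)
          (fun r hr => hpM ⟨hr.1, hr.2.trans_lt hps⟩)
        rcases h0 with h0 | h0
        · exact this (𝓝[>] t) inferInstance hI (by simpa [h0] using hlim)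
        · exact this (pure s) inferInstance ⟨hst, le_rfl⟩ (by
            rw [tendsto_pure_left]; intro U hU; rw [h0]; exact mem_of_mem_nhds hU)
      intro r hr
      rcases hr.1.eq_or_lt with rfl | hrt
      · refine eq_zero_of_isUnit_apply hunit (tendsto_nhds_unique hlim ?_)
        exact tendsto_const_nhds.congr' (by filter_upwards [hI] with q hq; exact (hz q hq).symm)
      · exact hz r ⟨hrt, hr.2⟩
    obtain ⟨δ, hδ, h1⟩ := hl
    obtain ⟨δ', hδ', h2⟩ := hr
    exact ⟨min δ δ', lt_min hδ hδ',
      fun s hs hst hs' => h1 s hs hst (by linarith [min_le_left δ δ']),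
      fun s hs hst hs' => h2 s hs hst (by linarith [min_le_right δ δ'])⟩

theorem SolOn.unique (hA : Admissible A V) (hab : a ≤ b) (h : SolOn A x (Icc a b))
    (h' : SolOn A y (Icc a b)) (h0 : x a = y a) : ∀ t ∈ Icc a b, x t = y t := fun t ht =>
  sub_eq_zero.1 ((h.sub h').eq_zero hA hab (.inl (sub_eq_zero.2 h0)) t ht)

/-- As `f a = 0`, the indefinite integral has no jump at `a`. It is the limit of the integrals from
s as s ↓ a, so only the variation inside the open interval counts, however large the jump of `A` at
`a`. -/
theorem norm_integral_le_half (hA : VarBound A V)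
    (hV : ∀ r ∈ Ioo a b, ∀ s ∈ Ioo a b, V s - V r ≤ 1 / 2) (hfa : f a = 0)
    (hM : ∀ t, ‖f t‖ ≤ M) {I : ℝ → F}
    (hI : ∀ t ≥ a, HasIntegralIcc (stieltjes A f) a t (I t)) (ht : t ∈ Ioo a b) :
    ‖I t‖ ≤ M / 2 := by
  have hIa : I a = 0 := (hI a le_rfl).unique le_rfl (.refl _ a)
  have h1 := tendsto_integral_nhdsGT (F := I) ht.1 fun s hs => by
    simpa [hIa] using hI s hs.1
  simp only [hIa, stieltjes, hfa, map_zero, sub_zero] at h1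
  have h2 : Tendsto (fun s => ‖I t - I s‖) (𝓝[>] a) (𝓝 ‖I t - 0‖) := (h1.const_sub (I t)).norm
  rw [sub_zero] at h2
  refine le_of_tendsto h2 ?_
  filter_upwards [Ioo_mem_nhdsGT ht.1] with s hs
  have h3 := (HasIntegralIcc.sub_left hs.1.le hs.2.le (hI s hs.1.le) (hI t ht.1.le)).norm_le hA
    hs.2.le fun τ _ => hM τ
  have hM0 : 0 ≤ M := (norm_nonneg _).trans (hM a)
  have h4 := mul_le_mul_of_nonneg_left (hV s ⟨hs.1, hs.2.trans ht.2⟩ t ht) hM0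
  linarith

/-- Picard iteration on an open interval where the variation of `A` is at most `1/2`. -/
theorem exists_picard_limit [CompleteSpace F] (hA : VarBound A V)
    (hV : ∀ r ∈ Ioo a b, ∀ s ∈ Ioo a b, V s - V r ≤ 1 / 2)
    (v : F) : ∃ S I : ℝ → F, (∀ t ∈ Icc a b, HasIntegralIcc (stieltjes A S) a t (I t)) ∧
      (∀ t ∈ Ioo a b, S t = v + I t) ∧ S a = 0 ∧ S b = 0 := by
  -- Iterates vanish off the open interval, so the end-point jumps of `A` do not enter. The bound is
  -- invariant since ‖v‖ + (2‖v‖)/2 = 2‖v‖.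
  let Q : (ℝ → F) → Prop := fun f => IsRegulated f ∧ (∀ t, ‖f t‖ ≤ 2 * ‖v‖) ∧
    ∀ t ∉ Ioo a b, f t = 0
  have step : ∀ f : Subtype Q, ∃ g : Subtype Q, ∃ I : ℝ → F,
      (∀ t ≥ a, HasIntegralIcc (stieltjes A f.1) a t (I t)) ∧
        ∀ t ∈ Ioo a b, g.1 t = v + I t := by
    rintro ⟨f, hreg, hM, hout⟩
    have hint : ∀ t, ∃ w, t ≥ a → HasIntegralIcc (stieltjes A f) a t w := fun t => by
      by_cases h : a ≤ t
      · obtain ⟨w, hw⟩ := hreg.exists_hasIntegralIcc hA h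
        exact ⟨w, fun _ => hw⟩
      · exact ⟨0, fun h' => absurd h' h⟩
    choose I hI using hint
    -- Clamping at `a` makes the variation dominated on the whole line; hence the next iterate is
    -- regulated and again integrable.
    have hvb : VarBound (fun t => v + I (max t a)) (fun t => 2 * ‖v‖ * V (max t a)) := by
      refine ⟨fun s t hst => mul_le_mul_of_nonneg_left (hA.mono (max_le_max_right a hst))
        (by positivity), fun s t hst => ?_⟩
      have hst' := max_le_max_right a hst
      rw [add_sub_add_left_eq_sub, ← mul_sub]
      exact (HasIntegralIcc.sub_left (le_max_right _ _) hst' (hI _ (le_max_right _ _))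
        (hI _ (le_max_right _ _))).norm_le hA hst' fun τ _ => hM τ
    refine ⟨⟨(Ioo a b).indicator fun t => v + I (max t a), hvb.isRegulated.indicator_Ioo a b,
      fun t => ?_, fun t ht => indicator_of_notMem ht _⟩, I, hI, fun t ht => ?_⟩
    · by_cases ht : t ∈ Ioo a b
      · rw [indicator_of_mem ht, max_eq_left ht.1.le]
        have := norm_integral_le_half hA hV (hout a (by simp)) hM hI ht
        linarith [norm_add_le v (I t)]
      · rw [indicator_of_notMem ht, norm_zero]; positivity
    · simp only [indicator_of_mem ht, max_eq_left ht.1.le]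
  choose T I hI hT using step
  let f₀ : Subtype Q := ⟨fun _ => 0, fun t => ⟨⟨0, tendsto_const_nhds⟩, ⟨0, tendsto_const_nhds⟩⟩,
    fun t => by simp, fun _ _ => rfl⟩
  let S : ℕ → Subtype Q := fun n => T^[n] f₀
  have hS : ∀ n, S (n + 1) = T (S n) := fun n => Function.iterate_succ_apply' T n f₀
  have hdist : ∀ n t, dist ((S n).1 t) ((S (n + 1)).1 t) ≤ 2 * ‖v‖ * (1 / 2) ^ n := by
    intro n
    induction n with
    | zero =>
      intro t
      have : (S 0).1 t = 0 := rfl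
      rw [this, dist_zero_left]
      simpa using (S 1).2.2.1 t
    | succ n ih =>
      intro t
      by_cases ht : t ∈ Ioo a b
      · rw [hS (n + 1), hT _ t ht]
        conv_lhs => rw [hS n]
        rw [hT _ t ht, ← hS n, dist_add_left, dist_eq_norm, pow_succ, ← mul_assoc, mul_one_div]
        refine norm_integral_le_half (f := fun t => (S n).1 t - (S (n + 1)).1 t)
          (I := fun t => I (S n) t - I (S (n + 1)) t) hA hV ?_
          (fun t => by rw [← dist_eq_norm]; exact ih t)
          (fun t ht => (hI _ t ht).stieltjes_sub (hI _ t ht)) ht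
        rw [(S n).2.2.2 a (by simp), (S (n + 1)).2.2.2 a (by simp), sub_zero]
      · rw [(S (n + 1)).2.2.2 t ht, (S (n + 1 + 1)).2.2.2 t ht, dist_self]
        positivity
  have hlim : ∀ t, ∃ w, Tendsto (fun n => (S n).1 t) atTop (𝓝 w) := fun t =>
    cauchySeq_tendsto_of_complete
      (cauchySeq_of_le_geometric (1 / 2) (2 * ‖v‖) (by norm_num) fun n => hdist n t)
  choose L hL using hlim
  have hunif : ∀ n t, ‖L t - (S n).1 t‖ ≤ 2 * ‖v‖ / (1 - 1 / 2) * (1 / 2) ^ n := fun n t => by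
    rw [← dist_eq_norm, dist_comm, div_mul_eq_mul_div]
    exact dist_le_of_le_geometric_of_tendsto (1 / 2) (2 * ‖v‖) (by norm_num)
      (fun n => hdist n t) (hL t) n
  have hI' : ∀ t, ∃ w, t ∈ Icc a b → HasIntegralIcc (stieltjes A L) a t w ∧
      Tendsto (fun n => I (S n) t) atTop (𝓝 w) := fun t => by
    by_cases ht : t ∈ Icc a b
    · obtain ⟨w, hw⟩ := exists_hasIntegralIcc_of_uniform_limit hA ht.1
        (ε := fun n : ℕ => 2 * ‖v‖ / (1 - 1 / 2) * (1 / 2) ^ n)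
        (by simpa using (tendsto_pow_atTop_nhds_zero_of_lt_one (by norm_num : (0 : ℝ) ≤ 1 / 2)
          (by norm_num)).const_mul (2 * ‖v‖ / (1 - 1 / 2)))
        (fun m n hmn => mul_le_mul_of_nonneg_left
          (pow_le_pow_of_le_one (by norm_num) (by norm_num) hmn)
          (div_nonneg (by positivity) (by norm_num)))
        (fun n τ _ => hunif n τ) (fun n => hI (S n) t ht.1)
      exact ⟨w, fun _ => hw⟩
    · exact ⟨0, fun h => absurd h ht⟩
  choose W hW using hI'
  have hzero : ∀ t ∉ Ioo a b, L t = 0 := fun t ht =>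
    tendsto_nhds_unique (hL t) (by simp [(S _).2.2.2 t ht])
  refine ⟨L, W, fun t ht => (hW t ht).1, fun t ht => ?_, hzero a (by simp), hzero b (by simp)⟩
  have h1 := (hL t).comp (tendsto_add_atTop_nat 1)
  refine tendsto_nhds_unique h1 (((hW t ⟨ht.1.le, ht.2.le⟩).2.const_add v).congr fun n => ?_)
  simp only [Function.comp_apply, hS, hT _ t ht]

/-- The Picard limit starts from the right limit (I + Δ⁺A(a))v. The value z at `b` solves (I -
Δ⁻A(b))z = x(b⁻). Adding the point values v and z at the ends adds exactly the two jump terms to the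
integral. -/
theorem exists_solOn_of_small [CompleteSpace F] (hA : Admissible A V) (hab : a < b)
    (hV : ∀ r ∈ Ioo a b, ∀ s ∈ Ioo a b, V s - V r ≤ 1 / 2) (v : F) :
    ∃ x, x a = v ∧ SolOn A x (Icc a b) := by
  obtain ⟨R, hR, -⟩ := hA.right a
  obtain ⟨L, hL, u, hu⟩ := hA.left b
  obtain ⟨S, I, hI, hS, hSa, hSb⟩ :=
    exists_picard_limit hA.toVarBound hV ((1 + (R - A a)) v)
  set z : F := ((u⁻¹ : (F →L[ℝ] F)ˣ) : F →L[ℝ] F) ((1 + (R - A a)) v + I b) with hz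
  have huz : (1 - (A b - L)) z = (1 + (R - A a)) v + I b := by
    rw [← hu, hz, ← mul_apply_eq_comp, Units.mul_inv,
      one_apply_eq_self]
  set x : ℝ → F := fun t => S t + (if t = a then v else 0) + (if t = b then z else 0) with hx
  have hxa : x a = v := by simp [hx, hSa, hab.ne]
  have hxb : x b = z := by simp [hx, hSb, hab.ne']
  refine ⟨x, hxa, solOn_of_base (s := a) fun t ht => .of_le ht.1 ?_⟩
  rcases ht.1.eq_or_lt with rfl | hat
  · simpa using HasIntegralIcc.refl _ a
  have h1 := (hI t ht).stieltjes_add (hasIntegralIcc_point_left hA.toVarBound hR hat v)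
  rcases ht.2.eq_or_lt with rfl | htb
  · have h2 := h1.stieltjes_add (hasIntegralIcc_point_right hL hab z)
    have h3 : x t - x a = I t + (R - A a) v + (A t - L) z := by
      have : z = (1 + (R - A a)) v + I t + (A t - L) z := by rw [← huz]; simp
      rw [hxa, hxb]
      nth_rewrite 1 [this]
      simp only [add_apply, one_apply_eq_self]
      abel
    rw [h3]
    exact h2
  · have h3 : x t - x a = I t + (R - A a) v := by
      rw [hxa]
      simp only [hx, hS t ⟨hat, htb⟩, if_neg hat.ne', if_neg htb.ne, add_apply,
        one_apply_eq_self]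
      abel
    rw [h3]
    exact h1.congr fun τ hτ s _ => by simp [hx, (hτ.2.trans_lt htb).ne]

theorem SolOn.glue (hab : a ≤ b) (hbc : b ≤ c) (h : SolOn A x (Icc a b))
    (h' : SolOn A y (Icc b c)) (hxy : y b = x b) :
    SolOn A (fun t => if t ≤ b then x t else y t) (Icc a c) := by
  set z : ℝ → F := fun t => if t ≤ b then x t else y t
  have h₁ : SolOn A z (Icc a b) := h.congr ordConnected_Icc fun t ht => (if_pos ht.2).symm
  have h₂ : SolOn A z (Icc b c) := h'.congr ordConnected_Icc fun t ht => by
    rcases ht.1.eq_or_lt with rfl | h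
    · simp [z, hxy]
    · exact (if_neg h.not_ge).symm
  refine solOn_of_base (s := b) fun t ht => ?_
  rcases le_total t b with htb | htb
  · exact h₁ b ⟨hab, le_rfl⟩ t ⟨ht.1, htb⟩
  · exact h₂ b ⟨le_rfl, hbc⟩ t ⟨htb, ht.2⟩

theorem exists_solOn_Icc [CompleteSpace F] (hA : Admissible A V) (hab : a ≤ b) (v : F) :
    ∃ x, x a = v ∧ SolOn A x (Icc a b) := by
  -- The initial value is quantified inside, since the right-hand piece starts from the value
  -- reached by the left-hand one.
  refine interval_induction (P := fun s t => ∀ v, ∃ x, x s = v ∧ SolOn A x (Icc s t)) hab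
    ?_ ?_ ?_ v
  · refine fun t _ v => ⟨fun _ => v, rfl, solOn_of_base (s := t) fun s hs => ?_⟩
    obtain rfl : s = t := le_antisymm hs.2 hs.1
    exact .of_le le_rfl (by simpa using HasIntegralIcc.refl _ s)
  · intro r s t _ hrs hst _ h₁ h₂ v
    obtain ⟨x, hx, hx'⟩ := h₁ v
    obtain ⟨y, hy, hy'⟩ := h₂ (x s)
    exact ⟨_, by simp [hrs, hx], hx'.glue hrs hst hy' hy⟩
  · intro t _
    obtain ⟨p, hp, hp'⟩ := exists_small_left hA.mono t
    obtain ⟨q, hq, hq'⟩ := exists_small_right hA.mono t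
    refine ⟨min (t - p) (q - t), lt_min (sub_pos.2 hp) (sub_pos.2 hq),
      fun s _ hst hs v => exists_solOn_of_small hA hst (fun r hr r' hr' => ?_) v,
      fun s _ hst hs v => exists_solOn_of_small hA hst (fun r hr r' hr' => ?_) v⟩
    · have := min_le_left (t - p) (q - t)
      exact hp' r ⟨by linarith [hr.1], hr.2⟩ r' ⟨by linarith [hr'.1], hr'.2⟩
    · have := min_le_right (t - p) (q - t)
      exact hq' r ⟨hr.1, by linarith [hr.2]⟩ r' ⟨hr'.1, by linarith [hr'.2]⟩

/-- Solutions on growing compact intervals agree by uniqueness, so each may be read off at its own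
right end point. -/
theorem exists_solOn_Ici [CompleteSpace F] (hA : Admissible A V) (a : ℝ) (v : F) :
    ∃ x, x a = v ∧ SolOn A x (Ici a) := by
  choose X hXa hX using fun t : ℝ => exists_solOn_Icc hA (le_max_right t a) v
  have hcons : ∀ s t, s ∈ Icc a t → X s s = X t s := fun s t hst => by
    have h1 := hX s
    have h2 := hX t
    rw [max_eq_left hst.1] at h1
    rw [max_eq_left (hst.1.trans hst.2)] at h2
    exact h1.unique hA hst.1 (h2.mono (Icc_subset_Icc_right hst.2)) ((hXa s).trans (hXa t).symm)
      s ⟨hst.1, le_rfl⟩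
  refine ⟨fun t => X t t, hXa a, solOn_of_base (s := a) fun t ht => ?_⟩
  have h2 := hX t
  rw [max_eq_left ht] at h2
  exact (h2.congr ordConnected_Icc (y := fun t => X t t) fun s hs => (hcons s t hs).symm) a
    ⟨le_rfl, ht⟩ t ⟨ht, le_rfl⟩

end Solutions

/-! ### Transfer along ring homomorphisms, boundedness, extension to the whole line. -/

theorem Admissible.map {R S Φ : Type*} [NormedRing R] [NormedRing S] [FunLike Φ R S]
    [RingHomClass Φ R S] (φ : Φ) (hφ : ∀ r, ‖φ r‖ ≤ ‖r‖) {A : ℝ → R} {V : ℝ → ℝ}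
    (hA : Admissible A V) : Admissible (fun t => φ (A t)) V := by
  have hc : Continuous φ := AddMonoidHomClass.continuous_of_bound φ 1 (by simpa using hφ)
  refine ⟨⟨hA.mono, fun s t hst => ?_⟩, fun t => ?_, fun t => ?_⟩
  · rw [← map_sub]
    exact (hφ _).trans (hA.norm_le s t hst)
  · obtain ⟨B, hB, hu⟩ := hA.left t
    exact ⟨φ B, (hc.tendsto B).comp hB, by simpa using hu.map φ⟩
  · obtain ⟨B, hB, hu⟩ := hA.right t
    exact ⟨φ B, (hc.tendsto B).comp hB, by simpa using hu.map φ⟩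

/-- Left multiplication as a ring homomorphism into the bounded operators. -/
noncomputable def leftMul (R : Type*) [NormedRing R] [NormedAlgebra ℝ R] : R →+* (R →L[ℝ] R) where
  toFun := ContinuousLinearMap.mul ℝ R
  map_one' := by ext; simp
  map_mul' _ _ := by ext; simp [mul_assoc]
  map_zero' := by simp
  map_add' := by simp

theorem leftMul_apply {R : Type*} [NormedRing R] [NormedAlgebra ℝ R] (r s : R) :
    leftMul R r s = r * s := rfl

/-- A function with one-sided limits is bounded on compact intervals. -/
theorem exists_norm_le_of_one_sided_limits {R : Type*} [NormedAddCommGroup R] {f : ℝ → R}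
    {a b : ℝ} (hab : a ≤ b) (hl : ∀ t ∈ Ioc a b, ∃ w, Tendsto f (𝓝[<] t) (𝓝 w))
    (hr : ∀ t ∈ Ico a b, ∃ w, Tendsto f (𝓝[>] t) (𝓝 w)) : ∃ M, ∀ t ∈ Icc a b, ‖f t‖ ≤ M := by
  refine interval_induction (P := fun s t => ∃ M, ∀ r ∈ Icc s t, ‖f r‖ ≤ M) hab ?_ ?_ ?_
  · refine fun t _ => ⟨‖f t‖, fun r hr => ?_⟩
    rw [le_antisymm hr.2 hr.1]
  · rintro r s t - - - - ⟨M, hM⟩ ⟨N, hN⟩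
    refine ⟨max M N, fun u hu => ?_⟩
    rcases le_total u s with h | h
    · exact (hM u ⟨hu.1, h⟩).trans (le_max_left _ _)
    · exact (hN u ⟨h, hu.2⟩).trans (le_max_right _ _)
  · intro t ht
    have h1 : ∃ δ > 0, ∀ s ∈ Icc a b, s < t → t - δ < s → ∃ M, ∀ r ∈ Icc s t, ‖f r‖ ≤ M := by
      rcases ht.1.eq_or_lt with rfl | hat
      · exact ⟨1, one_pos, fun s hs h => absurd hs.1 h.not_ge⟩
      obtain ⟨w, hw⟩ := hl t ⟨hat, ht.2⟩
      obtain ⟨M, hM⟩ := exists_norm_le_of_tendsto hw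
      obtain ⟨p, hp, hpM⟩ := mem_nhdsLT_iff_exists_Ioo_subset.1 hM
      refine ⟨t - p, sub_pos.2 hp, fun s _ _ hs => ⟨max M ‖f t‖, fun r hr => ?_⟩⟩
      rcases hr.2.eq_or_lt with rfl | hrt
      · exact le_max_right _ _
      · exact (hpM ⟨by linarith [hr.1], hrt⟩).trans (le_max_left _ _)
    have h2 : ∃ δ > 0, ∀ s ∈ Icc a b, t < s → s < t + δ → ∃ M, ∀ r ∈ Icc t s, ‖f r‖ ≤ M := by
      rcases ht.2.eq_or_lt with rfl | htb
      · exact ⟨1, one_pos, fun s hs h => absurd hs.2 h.not_ge⟩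
      obtain ⟨w, hw⟩ := hr t ⟨ht.1, htb⟩
      obtain ⟨M, hM⟩ := exists_norm_le_of_tendsto hw
      obtain ⟨p, hp, hpM⟩ := mem_nhdsGT_iff_exists_Ioo_subset.1 hM
      refine ⟨p - t, sub_pos.2 hp, fun s _ _ hs => ⟨max M ‖f t‖, fun r hr => ?_⟩⟩
      rcases hr.1.eq_or_lt with rfl | hrt
      · exact le_max_right _ _
      · exact (hpM ⟨hrt, by linarith [hr.2]⟩).trans (le_max_left _ _)
    obtain ⟨δ, hδ, h1⟩ := h1
    obtain ⟨δ', hδ', h2⟩ := h2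
    exact ⟨min δ δ', lt_min hδ hδ',
      fun s hs hst hs' => h1 s hs hst (by linarith [min_le_left δ δ']),
      fun s hs hst hs' => h2 s hs hst (by linarith [min_le_right δ δ'])⟩

section Extension

variable {R : Type*} [NormedRing R] {A : ℝ → R}

/-- A function of locally bounded variation on `[0, ∞)`, extended by a constant to the left,
has its variation dominated by a monotone function. -/
theorem varBound_extend (hA : LocallyBoundedVariationOn A (Ici 0)) :
    VarBound (fun t => A (max t 0)) fun t => variationOnFromTo A (Ici 0) 0 (max t 0) := by
  have h0 : ∀ t : ℝ, max t 0 ∈ Ici (0 : ℝ) := fun t => le_max_right t 0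
  refine ⟨fun s t hst => variationOnFromTo.monotoneOn hA self_mem_Ici (h0 s) (h0 t)
    (max_le_max_right 0 hst), fun s t hst => ?_⟩
  have hst' := max_le_max_right 0 hst
  rw [variationOnFromTo.sub_right hA self_mem_Ici (h0 t) (h0 s),
    variationOnFromTo.eq_of_le _ _ hst', ← dist_eq_norm]
  exact BoundedVariationOn.dist_le (hA _ _ (h0 s) (h0 t)) ⟨h0 t, hst', le_rfl⟩
    ⟨h0 s, le_rfl, hst'⟩

theorem admissible_extend [CompleteSpace R] (hA : LocallyBoundedVariationOn A (Ici 0))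
    (hl : ∀ t > 0, IsUnit (1 - (A t - Function.leftLim A t)))
    (hr : ∀ t ≥ 0, IsUnit (1 + (Function.rightLim A t - A t))) :
    Admissible (fun t => A (max t 0)) fun t => variationOnFromTo A (Ici 0) 0 (max t 0) := by
  have hV := varBound_extend hA
  refine ⟨hV, fun t => ?_, fun t => ?_⟩
  · rcases le_or_gt t 0 with ht | ht
    -- The point 0 belongs here: the constant extension has no left jump at 0, where (D) gives no
    -- information.
    · refine ⟨A 0, tendsto_const_nhds.congr' ?_, by simp [max_eq_right ht]⟩
      filter_upwards [self_mem_nhdsWithin] with s hs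
      rw [max_eq_right ((le_of_lt hs).trans ht)]
    · obtain ⟨B, hB⟩ := (hV.isRegulated t).1
      have hB' : Tendsto A (𝓝[<] t) (𝓝 B) := hB.congr' (by
        filter_upwards [Ioo_mem_nhdsLT ht] with s hs
        rw [max_eq_left hs.1.le])
      refine ⟨B, hB, ?_⟩
      have := hl t ht
      rwa [leftLim_eq_of_tendsto hB', ← congrArg A (max_eq_left ht.le)] at this
  · rcases lt_or_ge t 0 with ht | ht
    · refine ⟨A 0, tendsto_const_nhds.congr' ?_, by simp [max_eq_right ht.le]⟩
      filter_upwards [Ioo_mem_nhdsGT ht] with s hs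
      rw [max_eq_right hs.2.le]
    · obtain ⟨B, hB⟩ := (hV.isRegulated t).2
      have hB' : Tendsto A (𝓝[>] t) (𝓝 B) := hB.congr' (by
        filter_upwards [self_mem_nhdsWithin] with s hs
        rw [max_eq_left (ht.trans (le_of_lt hs))])
      refine ⟨B, hB, ?_⟩
      have := hr t ht
      rwa [rightLim_eq_of_tendsto hB', ← congrArg A (max_eq_left ht)] at this

end Extension

/-! ### Floquet theory of the fundamental solution. -/

/-- Kurzweil sums see only increments in the second variable. This removes the constant `C` in
A(t+ω) = A(t) + C. -/
theorem HasIntegralIcc.congr_add {X : Type*} [NormedAddCommGroup X] {G : ℝ → ℝ → X}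
    {K : ℝ → X} {a b : ℝ} {v : X} (h : HasIntegralIcc (fun τ t => G τ t + K τ) a b v) :
    HasIntegralIcc G a b v := by
  intro ε hε
  obtain ⟨δ, hδ, hS⟩ := h ε hε
  refine ⟨δ, hδ, fun P hP => ?_⟩
  simpa [TaggedPartition.sum] using hS P hP

section Fundamental

variable {R : Type*} [NormedRing R] [NormedAlgebra ℝ R] {A Φ : ℝ → R} {V : ℝ → ℝ} {J : Set ℝ}

theorem SolOn.mul_right (h : SolOn (fun t => leftMul R (A t)) Φ J) (r : R) :
    SolOn (fun t => leftMul R (A t)) (fun t => Φ t * r) J := by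
  intro c hc d hd
  have := (h c hc d hd).map ((ContinuousLinearMap.mul ℝ R).flip r)
  rw [← sub_mul]
  exact this.congr fun τ _ t _ => by simp [leftMul_apply, mul_assoc]

theorem SolOn.translate {ω : ℝ} (hω : 0 ≤ ω) {C : R} (hper : ∀ t ≥ 0, A (t + ω) - A t = C)
    (h : SolOn (fun t => leftMul R (A t)) Φ (Ici 0)) :
    SolOn (fun t => leftMul R (A t)) (fun t => Φ (t + ω)) (Ici 0) := by
  refine solOn_of_base (s := 0) fun t ht => .of_le ht ?_
  have ht : 0 ≤ t := ht
  have h1 := ((h (0 + ω) (by simpa using hω) (t + ω) (add_nonneg ht hω)).1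
    (by linarith)).translate ω
  refine HasIntegralIcc.congr_add (K := fun τ => C * Φ (τ + ω))
    (h1.congr fun τ _ s hs => ?_)
  simp only [stieltjes, leftMul_apply, ← hper s hs.1]
  noncomm_ring

/-- Both sides solve the equation on [0,∞) and take the value `Φ ω` at 0. -/
theorem fundamental_add_period (hA : Admissible (fun t => leftMul R (A t)) V)
    {ω : ℝ} (hω : 0 ≤ ω) {C : R} (hper : ∀ t ≥ 0, A (t + ω) - A t = C) (h0 : Φ 0 = 1)
    (h : SolOn (fun t => leftMul R (A t)) Φ (Ici 0)) {t : ℝ} (ht : 0 ≤ t) :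
    Φ (t + ω) = Φ t * Φ ω :=
  ((h.translate hω hper).mono Icc_subset_Ici_self).unique hA ht
    ((h.mul_right (Φ ω)).mono Icc_subset_Ici_self) (by simp [h0]) t ⟨ht, le_rfl⟩

theorem fundamental_add_nat_mul (hA : Admissible (fun t => leftMul R (A t)) V)
    {ω : ℝ} (hω : 0 ≤ ω) {C : R} (hper : ∀ t ≥ 0, A (t + ω) - A t = C) (h0 : Φ 0 = 1)
    (h : SolOn (fun t => leftMul R (A t)) Φ (Ici 0)) {t : ℝ} (ht : 0 ≤ t) (k : ℕ) :
    Φ (t + k * ω) = Φ t * Φ ω ^ k := by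
  induction k with
  | zero => simp
  | succ k ih =>
    rw [pow_succ, ← mul_assoc, ← ih,
      ← fundamental_add_period hA hω hper h0 h (add_nonneg ht (by positivity))]
    congr 1
    push_cast
    ring

/-- The one-sided limits of Φ are jump factors times Φ(t), hence units. Inversion is continuous at
units, so Φ⁻¹ has one-sided limits too. -/
theorem exists_norm_le_fundamental [CompleteSpace R]
    (hA : Admissible A V) (h : SolOn (fun t => leftMul R (A t)) Φ (Ici 0))
    (hu : ∀ t ≥ 0, IsUnit (Φ t)) {b : ℝ} (hb : 0 ≤ b) :
    ∃ M, ∀ t ∈ Icc 0 b, ‖Φ t‖ ≤ M ∧ ‖Ring.inverse (Φ t)‖ ≤ M := by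
  have hc : Continuous (leftMul R) := (ContinuousLinearMap.mul ℝ R).continuous
  have hl : ∀ t ∈ Ioc 0 b, ∃ u : Rˣ, Tendsto Φ (𝓝[<] t) (𝓝 u) := by
    intro t ht
    obtain ⟨B, hB, hB'⟩ := hA.left t
    obtain ⟨u, hu⟩ := hB'.mul (hu t ht.1.le)
    have := (h.mono Icc_subset_Ici_self).tendsto_nhdsLT ht.1 ((hc.tendsto B).comp hB)
    rw [← map_sub, ← map_one (leftMul R), ← map_sub, leftMul_apply, ← hu] at this
    exact ⟨u, this⟩
  have hr : ∀ t ∈ Ico 0 b, ∃ u : Rˣ, Tendsto Φ (𝓝[>] t) (𝓝 u) := by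
    intro t ht
    obtain ⟨B, hB, hB'⟩ := hA.right t
    obtain ⟨u, hu⟩ := hB'.mul (hu t ht.1)
    have := (h.mono (show Icc t b ⊆ Ici 0 from fun s hs => ht.1.trans hs.1)).tendsto_nhdsGT ht.2
      ((hc.tendsto B).comp hB)
    rw [← map_sub, ← map_one (leftMul R), ← map_add, leftMul_apply, ← hu] at this
    exact ⟨u, this⟩
  obtain ⟨M, hM⟩ := exists_norm_le_of_one_sided_limits hb
    (fun t ht => (hl t ht).imp' _ fun _ => id) (fun t ht => (hr t ht).imp' _ fun _ => id)
  obtain ⟨N, hN⟩ := exists_norm_le_of_one_sided_limits (f := fun t => Ring.inverse (Φ t)) hb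
    (fun t ht => (hl t ht).imp' _ fun u hu => (NormedRing.inverse_continuousAt u).tendsto.comp hu)
    (fun t ht => (hr t ht).imp' _ fun u hu => (NormedRing.inverse_continuousAt u).tendsto.comp hu)
  exact ⟨max M N, fun t ht => ⟨(hM t ht).trans (le_max_left _ _),
    (hN t ht).trans (le_max_right _ _)⟩⟩

end Fundamental

theorem exists_eq_add_nat_mul {ω t : ℝ} (hω : 0 < ω) (ht : 0 ≤ t) :
    ∃ k : ℕ, ∃ r, 0 ≤ r ∧ r < ω ∧ t = r + k * ω := by
  have h1 := Nat.floor_le (div_nonneg ht hω.le)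
  have h2 := Nat.lt_floor_add_one (t / ω)
  rw [le_div_iff₀ hω] at h1
  rw [div_lt_iff₀ hω] at h2
  exact ⟨⌊t / ω⌋₊, t - ⌊t / ω⌋₊ * ω, by linarith, by linarith, by ring⟩

/-- Floquet estimate: exponential decay of the powers of the monodromy element gives uniform
exponential decay of the transition operator. -/
theorem exists_exp_bound {R : Type*} [NormedRing R] {Φ : ℝ → R} {ω M K β : ℝ} (hω : 0 < ω)
    (hβ : 0 < β) (hK : 0 < K) (hu : ∀ t ≥ 0, IsUnit (Φ t))
    (hΦ : ∀ t ≥ 0, ∀ k : ℕ, Φ (t + k * ω) = Φ t * Φ ω ^ k)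
    (hM : ∀ t ∈ Icc 0 ω, ‖Φ t‖ ≤ M ∧ ‖Ring.inverse (Φ t)‖ ≤ M)
    (hX : ∀ k : ℕ, ‖Φ ω ^ k‖ ≤ K * Real.exp (-β * k)) :
    ∃ α > 0, ∃ L > 0, ∀ s ≥ 0, ∀ t ≥ s,
      ‖Φ t * Ring.inverse (Φ s)‖ ≤ L * Real.exp (-α * (t - s)) := by
  -- The factor e^β absorbs the offset t' - s' < ω within a period; the summand 1 keeps the constant
  -- positive when `M` is zero.
  refine ⟨β / ω, div_pos hβ hω, M * K * M * Real.exp β + 1, by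
    have : 0 ≤ M := (norm_nonneg _).trans (hM 0 ⟨le_rfl, hω.le⟩).1
    positivity, fun s hs t hst => ?_⟩
  obtain ⟨j, s', hs0, hs1, rfl⟩ := exists_eq_add_nat_mul hω hs
  obtain ⟨k, t', ht0, ht1, rfl⟩ := exists_eq_add_nat_mul hω (hs.trans hst)
  have hjk : j ≤ k := by
    have : (j : ℝ) * ω < (k + 1) * ω := by linarith
    exact Nat.lt_succ_iff.1 (by exact_mod_cast lt_of_mul_lt_mul_right this hω.le)
  obtain ⟨m, rfl⟩ := Nat.exists_eq_add_of_le hjk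
  have hM0 : 0 ≤ M := (norm_nonneg _).trans (hM 0 ⟨le_rfl, hω.le⟩).1
  have hXu := (hu ω hω.le).pow j
  have heq : Φ (t' + (j + m : ℕ) * ω) * Ring.inverse (Φ (s' + j * ω)) =
      Φ t' * Φ ω ^ m * Ring.inverse (Φ s') := by
    obtain ⟨p, hp⟩ := hu s' hs0
    obtain ⟨q, hq⟩ := hXu
    rw [hΦ t' ht0, hΦ s' hs0, add_comm j m, pow_add, ← hp, ← hq, ← Units.val_mul,
      Ring.inverse_unit, Ring.inverse_unit, mul_inv_rev, Units.val_mul]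
    simp [mul_assoc]
  rw [heq]
  have hexp : Real.exp (-β * m) ≤
      Real.exp β * Real.exp (-(β / ω) * (t' + (j + m : ℕ) * ω - (s' + j * ω))) := by
    rw [← Real.exp_add, Real.exp_le_exp]
    have : -(β / ω) * (t' + (j + m : ℕ) * ω - (s' + j * ω)) =
        -β * m - β / ω * (t' - s') := by
      push_cast
      field_simp
      ring
    rw [this]
    have h2 : β / ω * (t' - s') ≤ β / ω * ω :=
      mul_le_mul_of_nonneg_left (by linarith) (div_pos hβ hω).le
    rw [div_mul_cancel₀ _ hω.ne'] at h2
    linarith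
  have hE := Real.exp_pos (-(β / ω) * (t' + (j + m : ℕ) * ω - (s' + j * ω)))
  calc ‖Φ t' * Φ ω ^ m * Ring.inverse (Φ s')‖
      ≤ ‖Φ t'‖ * ‖Φ ω ^ m‖ * ‖Ring.inverse (Φ s')‖ :=
        (norm_mul_le _ _).trans (mul_le_mul_of_nonneg_right (norm_mul_le _ _) (norm_nonneg _))
    _ ≤ M * (K * Real.exp (-β * m)) * M := by
        gcongr
        · exact (hM t' ⟨ht0, ht1.le⟩).1
        · exact hX m
        · exact (hM s' ⟨hs0, hs1.le⟩).2
    _ ≤ M * (K * (Real.exp β *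
          Real.exp (-(β / ω) * (t' + (j + m : ℕ) * ω - (s' + j * ω))))) * M := by gcongr
    _ ≤ _ := by nlinarith

/-! ### Eigenvalues and powers of the monodromy matrix. -/

section Spectrum

variable {n : ℕ}

theorem exists_norm_pow_le (X : Matrix (Fin n) (Fin n) ℝ)
    (h : ∀ ρ : ℂ, Module.End.HasEigenvalue
      (Matrix.toLin' (X.map (algebraMap ℝ ℂ))) ρ → ‖ρ‖ < 1) :
    ∃ β > 0, ∃ K > 0, ∀ k : ℕ, ‖X ^ k‖ ≤ K * Real.exp (-β * k) := by
  set Y : Matrix (Fin n) (Fin n) ℂ := X.map (algebraMap ℝ ℂ) with hY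
  have hrad : spectralRadius ℂ Y < 1 := by
    -- The spectrum is empty only for n = 0.
    rcases (spectrum ℂ Y).eq_empty_or_nonempty with he | hne
    · simp [spectralRadius, he]
    · refine spectrum.spectralRadius_lt_of_forall_lt_of_nonempty (r := 1) hne fun ρ hρ => ?_
      rw [← Matrix.spectrum_toLin', ← Module.End.hasEigenvalue_iff_mem_spectrum] at hρ
      exact_mod_cast h ρ hρ
  obtain ⟨r, hr, hr1⟩ := ENNReal.lt_iff_exists_nnreal_btwn.1 hrad
  have hr0 : 0 < r := by exact_mod_cast zero_le.trans_lt hr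
  have hr1' : r < 1 := by exact_mod_cast hr1
  -- Gelfand's formula; the finitely many remaining powers go into the constant.
  have hev : ∀ᶠ k : ℕ in atTop, ‖Y ^ k‖ / r ^ k ≤ 1 := by
    filter_upwards [(spectrum.pow_nnnorm_pow_one_div_tendsto_nhds_spectralRadius Y).eventually
      (gt_mem_nhds hr), eventually_gt_atTop 0] with k hk hk0
    rw [div_le_one (by positivity)]
    have hk' : (0 : ℝ) < k := by exact_mod_cast hk0
    have := ENNReal.rpow_le_rpow hk.le hk'.le
    rw [← ENNReal.rpow_mul, one_div_mul_cancel hk'.ne', ENNReal.rpow_one,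
      ENNReal.rpow_natCast] at this
    exact_mod_cast this
  obtain ⟨N, hN⟩ := eventually_atTop.1 hev
  obtain ⟨K₁, hK₁⟩ := ((Finset.range N).image fun k => ‖Y ^ k‖ / (r : ℝ) ^ k).bddAbove
  have hbd : ∀ k, ‖Y ^ k‖ ≤ max K₁ 1 * r ^ k := fun k => by
    rw [← div_le_iff₀ (by positivity)]
    rcases lt_or_ge k N with hk | hk
    · exact (hK₁ (by simpa using ⟨k, hk, rfl⟩)).trans (le_max_left _ _)
    · exact (hN k hk).trans (le_max_right _ _)
  -- Entrywise real part is a bounded linear map sending Y^k to X^k, which avoids comparing the real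
  -- and complex operator norms.
  let T : Matrix (Fin n) (Fin n) ℂ →ₗ[ℝ] Matrix (Fin n) (Fin n) ℝ :=
    { toFun := fun M => M.map Complex.re
      map_add' := fun _ _ => by ext; simp
      map_smul' := fun _ _ => by ext; simp }
  have hT : ∀ k, T.toContinuousLinearMap (Y ^ k) = X ^ k := fun k => by
    have : Y ^ k = (X ^ k).map (algebraMap ℝ ℂ) :=
      (map_pow (RingHom.mapMatrix (algebraMap ℝ ℂ)) X k).symm
    rw [this]
    ext i j
    simp [T]
  have hlog : Real.log r < 0 := Real.log_neg (by exact_mod_cast hr0) (by exact_mod_cast hr1')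
  refine ⟨-Real.log r, neg_pos.2 hlog, (‖T.toContinuousLinearMap‖ + 1) * max K₁ 1,
    by positivity, fun k => ?_⟩
  have hexp : Real.exp (- -Real.log r * k) = (r : ℝ) ^ k := by
    rw [neg_neg, mul_comm, Real.exp_nat_mul, Real.exp_log (by exact_mod_cast hr0)]
  rw [hexp, ← hT, mul_assoc]
  refine (T.toContinuousLinearMap.le_opNorm _).trans (mul_le_mul (by linarith) (hbd k)
    (norm_nonneg _) (by positivity))

/-- Decay on the real basis vectors sends the entries of X^k to zero, hence also ρ^k w = X^k w for a
complex eigenvector w; a nonzero coordinate of w then gives ρ^k → 0. -/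
theorem norm_eigenvalue_lt_one (X : Matrix (Fin n) (Fin n) ℝ)
    (h : ∀ v : EuclideanSpace ℝ (Fin n),
      Tendsto (fun k : ℕ => Matrix.toEuclideanCLM (𝕜 := ℝ) (X ^ k) v) atTop (𝓝 0)) (ρ : ℂ)
    (hρ : Module.End.HasEigenvalue (Matrix.toLin' (X.map (algebraMap ℝ ℂ))) ρ) : ‖ρ‖ < 1 := by
  have hent : ∀ i j, Tendsto (fun k : ℕ => (X ^ k) i j) atTop (𝓝 0) := fun i j => by
    have := ((EuclideanSpace.proj i : EuclideanSpace ℝ (Fin n) →L[ℝ] ℝ).continuous.tendsto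
      0).comp (h (EuclideanSpace.single j 1))
    rw [map_zero] at this
    refine this.congr fun k => ?_
    change ((X ^ k).mulVec (Pi.single j 1)) i = _
    simp
  obtain ⟨w, hw⟩ := hρ.exists_hasEigenvector
  have hpow : ∀ k : ℕ, ((X ^ k).map (algebraMap ℝ ℂ)).mulVec w = ρ ^ k • w := fun k => by
    have h1 : (X ^ k).map (algebraMap ℝ ℂ) = X.map (algebraMap ℝ ℂ) ^ k :=
      map_pow (RingHom.mapMatrix (algebraMap ℝ ℂ)) X k
    rw [h1, ← Matrix.toLin'_apply, Matrix.toLin'_pow, hw.pow_apply k]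
  obtain ⟨i, hi⟩ := Function.ne_iff.1 hw.2
  have hlim : Tendsto (fun k : ℕ => ρ ^ k * w i) atTop (𝓝 0) := by
    have h2 : Tendsto (fun k : ℕ => ∑ j, ((X ^ k) i j : ℂ) * w j) atTop (𝓝 (∑ j, (0 : ℝ) * w j)) :=
      tendsto_finsetSum _ fun j _ =>
        (((Complex.continuous_ofReal.tendsto 0).comp (hent i j)).mul_const (w j))
    simp only [Complex.ofReal_zero, zero_mul, Finset.sum_const_zero] at h2
    refine h2.congr fun k => ?_
    have := congrFun (hpow k) i
    simpa [Matrix.mulVec, dotProduct] using this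
  have h3 : Tendsto (fun k : ℕ => ρ ^ k) atTop (𝓝 0) := by
    have := hlim.mul_const (w i)⁻¹
    rw [zero_mul] at this
    exact this.congr fun k => mul_inv_cancel_right₀ hi _
  exact tendsto_pow_atTop_nhds_zero_iff_norm_lt_one.1 h3

end Spectrum

/-! ### From the fundamental solution to the transition matrix. -/

section Transition

variable {n : ℕ} {A A' Φ : ℝ → Matrix (Fin n) (Fin n) ℝ} {V : ℝ → ℝ}

theorem SolOn.toEuclideanCLM_apply {J : Set ℝ} (h : SolOn (fun t => leftMul _ (A t)) Φ J)
    (v : EuclideanSpace ℝ (Fin n)) :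
    SolOn (fun t => Matrix.toEuclideanCLM (𝕜 := ℝ) (A t))
      (fun t => Matrix.toEuclideanCLM (𝕜 := ℝ) (Φ t) v) J := by
  let T : Matrix (Fin n) (Fin n) ℝ →L[ℝ] EuclideanSpace ℝ (Fin n) :=
    LinearMap.toContinuousLinearMap
      { toFun := fun M => Matrix.toEuclideanCLM (𝕜 := ℝ) M v
        map_add' := fun _ _ => by simp
        map_smul' := fun _ _ => by simp }
  have hT : ∀ M, T M = Matrix.toEuclideanCLM (𝕜 := ℝ) M v := fun _ => rfl
  intro c hc d hd
  have := (h c hc d hd).map T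
  rw [map_sub] at this
  exact this.congr fun τ _ t _ => by
    simp only [stieltjes, leftMul_apply, hT, map_mul, mul_apply_eq_comp]

/-- If Φ(t)v = 0, the solution Φ(·)v vanishes at `t`, hence by backward uniqueness at 0, where it
equals v. -/
theorem isUnit_fundamental
    (hA : Admissible (fun t => Matrix.toEuclideanCLM (𝕜 := ℝ) (A t)) V) (h0 : Φ 0 = 1)
    (h : SolOn (fun t => leftMul _ (A t)) Φ (Ici 0)) {t : ℝ} (ht : 0 ≤ t) : IsUnit (Φ t) := by
  rw [← Matrix.mulVec_injective_iff_isUnit]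
  refine (injective_iff_map_eq_zero (Matrix.mulVecLin (Φ t))).2 fun v hv => ?_
  have := ((h.toEuclideanCLM_apply (WithLp.toLp 2 v)).mono
    (show Icc 0 t ⊆ Ici 0 from Icc_subset_Ici_self)).eq_zero hA ht (.inr (by
      rw [Matrix.toEuclideanCLM_toLp]
      rw [Matrix.mulVecLin_apply] at hv
      rw [hv]
      rfl)) 0 ⟨le_rfl, ht⟩
  rw [h0, map_one, one_apply_eq_self] at this
  exact congrArg WithLp.ofLp this

theorem isSolutionOn_iff (hAA : ∀ t ≥ 0, A' t = A t) {x : ℝ → EuclideanSpace ℝ (Fin n)}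
    {J : Set ℝ} (hJ : J ⊆ Ici 0) :
    IsSolutionOn A x J ↔ SolOn (fun t => Matrix.toEuclideanCLM (𝕜 := ℝ) (A' t)) x J := by
  have h0 : ∀ c ∈ J, ∀ d ∈ J, ∀ t ∈ uIcc c d, A' t = A t := fun c hc d hd t ht =>
    hAA t ((le_min (hJ hc) (hJ hd)).trans ht.1)
  exact ⟨fun h c hc d hd => (h c hc d hd).congr fun τ _ t ht => by
      simp only [stieltjes, h0 c hc d hd t ht],
    fun h c hc d hd => (h c hc d hd).congr fun τ _ t ht => by
      simp only [stieltjes, h0 c hc d hd t ht]⟩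

theorem isTransitionMatrix_iff (hAA : ∀ t ≥ 0, A' t = A t)
    {U : ℝ → ℝ → Matrix (Fin n) (Fin n) ℝ} :
    IsTransitionMatrix A U ↔ ∀ s ≥ 0, U s s = 1 ∧
      SolOn (fun t => leftMul _ (A' t)) (fun t => U t s) (Ici 0) := by
  have h0 : ∀ c ≥ 0, ∀ d ≥ 0, ∀ t ∈ uIcc c d, A' t = A t := fun c hc d hd t ht =>
    hAA t ((le_min hc hd).trans ht.1)
  constructor
  · intro h s hs
    have h1 : U s s = 1 := sub_eq_zero.1
      (((h s hs s hs).1 le_rfl).unique le_rfl (.refl _ s))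
    refine ⟨h1, solOn_of_base (s := s) fun t ht => ?_⟩
    rw [h1]
    exact (h t ht s hs).congr fun τ _ r hr => by
      simp only [stieltjes, leftMul_apply, h0 s hs t ht r hr]
  · intro h t ht s hs
    have h1 := (h s hs).2 s hs t ht
    beta_reduce at h1
    rw [(h s hs).1] at h1
    exact h1.congr fun τ _ r hr => by
      simp only [stieltjes, leftMul_apply, h0 s hs t ht r hr]

theorem SolOn.eq_transition_apply
    (hA : Admissible (fun t => Matrix.toEuclideanCLM (𝕜 := ℝ) (A t)) V)
    (h : SolOn (fun t => leftMul _ (A t)) Φ (Ici 0)) {s t : ℝ} (hs : 0 ≤ s) (hst : s ≤ t)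
    (hu : IsUnit (Φ s)) {x : ℝ → EuclideanSpace ℝ (Fin n)}
    (hx : SolOn (fun t => Matrix.toEuclideanCLM (𝕜 := ℝ) (A t)) x (Ici s)) :
    x t = Matrix.toEuclideanCLM (𝕜 := ℝ) (Φ t * Ring.inverse (Φ s)) (x s) :=
  (hx.mono Icc_subset_Ici_self).unique hA hst
    (((h.mul_right (Ring.inverse (Φ s))).toEuclideanCLM_apply (x s)).mono
      fun _ hr => hs.trans hr.1)
    (by rw [Ring.mul_inverse_cancel _ hu, map_one, one_apply_eq_self]) t ⟨hst, le_rfl⟩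

end Transition

end GLDE

/-! ### The main theorem. -/

open Filter Topology GLDE

theorem corollary3p7 (n : ℕ) (A : ℝ → Matrix (Fin n) (Fin n) ℝ)
    (hA : LocallyBoundedVariationOn A (Set.Ici 0)) (hD : GLDE.ConditionD A)
    (ω : ℝ) (hω : 0 < ω) (C : Matrix (Fin n) (Fin n) ℝ)
    (hper : ∀ t ≥ 0, A (t + ω) - A t = C) :
    ∃ U : ℝ → ℝ → Matrix (Fin n) (Fin n) ℝ,
      GLDE.IsTransitionMatrix A U ∧
      (∀ V : ℝ → ℝ → Matrix (Fin n) (Fin n) ℝ, GLDE.IsTransitionMatrix A V →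
        ∀ t ≥ 0, ∀ s ≥ 0, V t s = U t s) ∧
      (GLDE.GloballyUniformlyExponentiallyStable A ↔
        ∀ ρ : ℂ, Module.End.HasEigenvalue
          (Matrix.toLin' ((U ω 0).map (algebraMap ℝ ℂ))) ρ → ‖ρ‖ < 1) := by
  have hadm := admissible_extend hA hD.1 hD.2
  set A' : ℝ → Matrix (Fin n) (Fin n) ℝ := fun t => A (max t 0)
  have hAA : ∀ t ≥ 0, A' t = A t := fun t ht => congrArg A (max_eq_left ht)
  have hper' : ∀ t ≥ 0, A' (t + ω) - A' t = C := fun t ht => by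
    rw [hAA t ht, hAA _ (add_nonneg ht hω.le), hper t ht]
  -- The abstract theory is used for two operator equations: left multiplication on matrices, and
  -- the action on Euclidean vectors.
  have hM := hadm.map (leftMul _) (ContinuousLinearMap.opNorm_mul_apply_le ℝ _)
  have hE := hadm.map (Matrix.toEuclideanCLM (𝕜 := ℝ) (n := Fin n)) fun _ => le_rfl
  obtain ⟨Φ, h0, hΦ⟩ := exists_solOn_Ici hM 0 1
  have hu : ∀ t ≥ 0, IsUnit (Φ t) := fun t ht => isUnit_fundamental hE h0 hΦ ht
  have hpow : ∀ t ≥ 0, ∀ k : ℕ, Φ (t + k * ω) = Φ t * Φ ω ^ k := fun t ht k =>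
    fundamental_add_nat_mul hM hω.le hper' h0 hΦ ht k
  have hU : IsTransitionMatrix A fun t s => Φ t * Ring.inverse (Φ s) :=
    (isTransitionMatrix_iff hAA).2 fun s hs =>
      ⟨Ring.mul_inverse_cancel _ (hu s hs), hΦ.mul_right _⟩
  refine ⟨fun t s => Φ t * Ring.inverse (Φ s), hU, fun W hW t ht s hs => ?_, ?_⟩
  · rw [isTransitionMatrix_iff hAA] at hU hW
    have hsub := (hW s hs).2.sub (hU s hs).2
    have hs0 : W s s - Φ s * Ring.inverse (Φ s) = 0 := by
      rw [(hW s hs).1, (hU s hs).1, sub_self]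
    refine sub_eq_zero.1 ?_
    -- Here t may precede s, so uniqueness is needed from either end point.
    rcases le_total s t with hst | hst
    · exact (hsub.mono fun r hr => hs.trans hr.1).eq_zero hM hst (.inl hs0) t ⟨hst, le_rfl⟩
    · exact (hsub.mono fun r hr => ht.trans hr.1).eq_zero hM hst (.inr hs0) t ⟨le_rfl, hst⟩
  · simp only [h0, Ring.inverse_one, mul_one]
    constructor
    · rintro ⟨α, hα, K, -, hstab⟩
      refine norm_eigenvalue_lt_one _ fun v => ?_
      -- Stability is tested on Φ(·)v at the multiples of `ω`, where Φ(kω) = Φ(ω)^k.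
      have hlim : Tendsto (fun k : ℕ => K * ‖v‖ * Real.exp (-(α * ω)) ^ k) atTop (𝓝 0) := by
        simpa using (tendsto_pow_atTop_nhds_zero_of_lt_one (Real.exp_pos _).le
          (Real.exp_lt_one_iff.2 (neg_neg_of_pos (mul_pos hα hω)))).const_mul (K * ‖v‖)
      refine squeeze_zero_norm (fun k => ?_) hlim
      have h1 := hstab 0 le_rfl _ ((isSolutionOn_iff hAA Subset.rfl).2
        (hΦ.toEuclideanCLM_apply v)) (0 + k * ω) (by positivity)
      rw [hpow 0 le_rfl k, h0, one_mul, map_one, one_apply_eq_self] at h1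
      refine h1.trans_eq ?_
      rw [← Real.exp_nat_mul]
      congr 2
      ring
    · intro hρ
      obtain ⟨β, hβ, K, hK, hX⟩ := exists_norm_pow_le _ hρ
      obtain ⟨M, hMb⟩ := exists_norm_le_fundamental hadm hΦ hu hω.le
      obtain ⟨α, hα, L, hL, hbound⟩ := exists_exp_bound hω hβ hK hu hpow hMb hX
      refine ⟨α, hα, L, hL, fun s hs x hx t hst => ?_⟩
      rw [isSolutionOn_iff hAA (Ici_subset_Ici.2 hs)] at hx
      rw [hΦ.eq_transition_apply hE hs hst (hu s hs) hx]
      refine (ContinuousLinearMap.le_opNorm _ _).trans ?_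
      rw [Matrix.l2_opNorm_toEuclideanCLM]
      calc _ ≤ L * Real.exp (-α * (t - s)) * ‖x s‖ :=
            mul_le_mul_of_nonneg_right (hbound s hs t hst) (norm_nonneg _)
        _ = _ := by ring
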